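/- **Theorem 3.1.** Let $\mathcal A$ be a unital C*-algebra with an increasing sequence $(\mathcal A_n)_{n\ge 0}$ of *-subalgebras containing the unit of $\mathcal A$ whose union is dense in $\mathcal A$, such that $\mathcal A_0=\mathbb C I$ and $\mathcal A_n\cong \mathcal M_{m_n}(\mathbb C)$ for every $n$, where $(m_n)_{n\ge0}$ is strictly increasing (so $\mathcal A$ is a UHF algebra). Then $\mathcal A$ has a unique tracial state $\tau$. Let $H$ be the GNS Hilbert space of $\tau$, on which $\mathcal A$ acts by the GNS representation, let $\eta:\mathcal A\to H$ be the canonical map, let $P_n$ be the orthogonal projection of $H$ onto $\eta(\mathcal A_n)$, and put $Q_n=P_n-P_{n-1}$ for $n\ge1$. For real numbers $(\alpha_n)_{n\ge1}$ let $D=\sum_{n\ge1}\alpha_nQ_n$ be the operator on $H$ with domain $\{x\in H:\sum_{n\ge 1}\alpha_nQ_nx \text{ converges}\}$. For a self-adjoint operator $D$ on $H$ and $a\in\mathcal A$, we say that $[D,a]$ is bounded if $a$ maps $\operatorname{dom}D$ into itself and $Da-aD$ is bounded on $\operatorname{dom}D$; $\|[D,a]\|$ is then the norm of its bounded extension to $H$.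 The pair $(H,D)$ is an *unbounded Fredholm module* over $\mathcal A$ if $D$ is self-adjoint, the set of $a\in\mathcal A$ with $[D,a]$ bounded is norm dense in $\mathcal A$, and $(I+D^2)^{-1}$ is compact. For $p>0$ it is *$p$-summable* if $\operatorname{trace}\big((I+D^2)^{-p/2}\big)<\infty$. We say that $D$ *induces a metric for the weak\*-topology* if $$d(\phi,\psi)=\sup\{|\phi(a)-\psi(a)| : a\in\mathcal A,\ [D,a]\text{ bounded},\ \|[D,a]\|\le1\}$$ is a (finite-valued) metric on the state space of $\mathcal A$ whose topology is the weak*-topology. (i) If $(\beta_n)_{n\ge1}$ are non-zero real numbers with $\sum_{n\ge1}|\beta_n|<\infty$, then for $$D=\sum_{n=1}^\infty \beta_n^{-1}\sqrt{m_n}\,Q_n$$ the pair $(H,D)$ is an unbounded Fredholm module over $\mathcal A$, $D$ induces a metric for the weak*-topology, and the module is $4$-summable. (ii) If $0<p<2$ and $s>2/p$, then for $$D=\sum_{n=1}^\infty m_n^{\,s}\,Q_n$$ the pair $(H,D)$ is an unbounded Fredholm module over $\mathcal A$, $D$ induces a metric for the weak*-topology, and the module is $p$-summable. -/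

import Mathlib

open scoped ComplexOrder InnerProductSpace

noncomputable section

namespace UHFTriple

/-! ### Unbounded operators, commutators, spectral triples -/

section Operators

variable {H : Type*} [NormedAddCommGroup H] [InnerProductSpace ℂ H] [CompleteSpace H]

/-- The operator `∑_{n ≥ 1} α n • Q n`, on its natural domain, which consists of the vectors `x`
for which the series `∑_{n ≥ 1} α n • Q n x` converges (unconditionally) in `H`.  The value `α 0`
plays no role. -/
def seriesOp (Q : ℕ → H →L[ℂ] H) (α : ℕ → ℝ) : H →ₗ.[ℂ] H where
  domain :=
    { carrier := {x | Summable fun n : ℕ => (α (n + 1) : ℂ) • Q (n + 1) x}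
      add_mem' := by
        intro x y hx hy
        simpa only [Set.mem_ofPred_eq, map_add, smul_add] using Summable.add hx hy
      zero_mem' := by
        simpa only [Set.mem_ofPred_eq, map_zero, smul_zero] using (summable_zero)
      smul_mem' := by
        intro c x hx
        simpa only [Set.mem_ofPred_eq, map_smul, smul_comm c] using Summable.const_smul c hx }
  toFun :=
    { toFun := fun x => ∑' n : ℕ, (α (n + 1) : ℂ) • Q (n + 1) (x : H)
      map_add' := by
        intro x y
        have h := Summable.tsum_add x.2 y.2
        simpa only [Submodule.coe_add, map_add, smul_add] using h
      map_smul' := by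
        intro c x
        have h := Summable.tsum_const_smul c x.2
        simpa only [Submodule.coe_smul, map_smul, smul_comm c, RingHom.id_apply] using h }

/-- The bounded operator `T` is the closure of the commutator `[D, a] = D a - a D`: the operator `a`
maps the domain of `D` into itself, and `T x = D (a x) - a (D x)` for every `x` in the domain of `D`
(which is dense when `D` is self-adjoint). -/
def IsCommutator (D : H →ₗ.[ℂ] H) (a T : H →L[ℂ] H) : Prop :=
  ∃ h : ∀ x : D.domain, a x ∈ D.domain, ∀ x : D.domain, D ⟨a x, h x⟩ - a (D x) = T x

/-- The bounded operator `R` is the (two-sided) inverse of the unbounded operator `I + D²`, whose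
domain consists of the `x` in the domain of `D` for which `D x` is in the domain of `D`. -/
def IsInverseOneAddSq (D : H →ₗ.[ℂ] H) (R : H →L[ℂ] H) : Prop :=
  (∀ y : H, ∃ (h₁ : R y ∈ D.domain) (h₂ : D ⟨R y, h₁⟩ ∈ D.domain),
    R y + D ⟨D ⟨R y, h₁⟩, h₂⟩ = y) ∧
  ∀ (x : H) (h₁ : x ∈ D.domain) (h₂ : D ⟨x, h₁⟩ ∈ D.domain), R (x + D ⟨D ⟨x, h₁⟩, h₂⟩) = x

/-- `T` is a positive operator of finite trace: `∑ ⟪e i, T (e i)⟫ < ∞` for every orthonormal basis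
`e` of `H`. -/
def HasFiniteTrace (T : H →L[ℂ] H) : Prop :=
  T.IsPositive ∧
    ∀ (s : Set H) (e : HilbertBasis s ℂ H), Summable fun i => (⟪e i, T (e i)⟫_ℂ).re

/-- `trace ((I + D²)^(-p/2)) < ∞`; the power is taken in the continuous functional calculus of
the positive bounded operator `(I + D²)⁻¹`. -/
def IsSummable (D : H →ₗ.[ℂ] H) (p : ℝ) : Prop :=
  ∃ R : H →L[ℂ] H, IsInverseOneAddSq D R ∧ HasFiniteTrace (CFC.rpow R (p / 2))

variable {A : Type*} [CStarAlgebra A]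

/-- `(H, D)`, where `A` acts on `H` through the `*`-representation `π`, is an unbounded Fredholm
module over `A`. -/
structure IsFredholmModule (π : A →⋆ₐ[ℂ] (H →L[ℂ] H)) (D : H →ₗ.[ℂ] H) : Prop where
  selfAdjoint : IsSelfAdjoint D
  dense_bounded_commutator : Dense {a : A | ∃ T : H →L[ℂ] H, IsCommutator D (π a) T}
  compact_resolvent : ∃ R : H →L[ℂ] H, IsInverseOneAddSq D R ∧ IsCompactOperator R

variable (A) in
/-- The state space of `A` with the weak-* topology (as a subset of `WeakDual ℂ A`). -/
def stateSpace : Set (WeakDual ℂ A) := {φ | φ 1 = 1 ∧ ∀ a : A, 0 ≤ φ (star a * a)}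

/-- `d(φ, ψ) = sup {|φ a - ψ a| : a ∈ A, ‖[D, a]‖ ≤ 1}`, with values in `[0, ∞]`. -/
def connesDist (π : A →⋆ₐ[ℂ] (H →L[ℂ] H)) (D : H →ₗ.[ℂ] H) (φ ψ : stateSpace A) : ENNReal :=
  ⨆ a ∈ {a : A | ∃ T : H →L[ℂ] H, IsCommutator D (π a) T ∧ ‖T‖ ≤ 1},
    ENNReal.ofReal ‖φ.1 a - ψ.1 a‖

/-- The function `connesDist π D` is a (finite-valued) metric on the state space of `A`, and the
topology of this metric is the weak-* topology. -/
def InducesWeakStarMetric (π : A →⋆ₐ[ℂ] (H →L[ℂ] H)) (D : H →ₗ.[ℂ] H) : Prop :=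
  ∃ d : MetricSpace (stateSpace A),
    (∀ φ ψ : stateSpace A, connesDist π D φ ψ = ENNReal.ofReal (d.dist φ ψ)) ∧
    d.toPseudoMetricSpace.toUniformSpace.toTopologicalSpace =
      (instTopologicalSpaceSubtype : TopologicalSpace (stateSpace A))

end Operators

/-! ### UHF algebras and the Dirac operators of a filtration -/

section UHF

variable {A : Type*} [CStarAlgebra A]

/-- `S 0 ⊆ S 1 ⊆ ...` is an increasing sequence of unital `*`-subalgebras of `A` with dense union,
`S 0 = ℂ 1`, and `S n` is isomorphic to the algebra of complex `m n × m n` matrices, where the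
sequence `m` is strictly increasing. -/
structure IsUHFFiltration (S : ℕ → StarSubalgebra ℂ A) (m : ℕ → ℕ) : Prop where
  mono : Monotone S
  bot : S 0 = ⊥
  dense : Dense (⋃ n, (S n : Set A))
  matrix : ∀ n, Nonempty (S n ≃⋆ₐ[ℂ] Matrix (Fin (m n)) (Fin (m n)) ℂ)
  strictMono : StrictMono m

variable [PartialOrder A] [StarOrderedRing A]

/-- The positive functional `τ` is a tracial state. -/
def IsTracialState (τ : A →ₚ[ℂ] ℂ) : Prop :=
  τ 1 = 1 ∧ ∀ a b : A, τ (a * b) = τ (b * a)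

/-- The canonical map `η : a ↦ a ξ` of `A` to the GNS Hilbert space of `τ`. -/
def gnsVec (τ : A →ₚ[ℂ] ℂ) : A →ₗ[ℂ] τ.GNS :=
  (UniformSpace.Completion.toComplL : τ.PreGNS →L[ℂ] τ.GNS).toLinearMap ∘ₗ
    τ.toPreGNS.toLinearMap

/-- The map `gnsVec τ` is `a ↦ a ξ` where `ξ` is the image of `1`. -/
theorem gnsVec_eq (τ : A →ₚ[ℂ] ℂ) (a : A) : gnsVec τ a = τ.gnsStarAlgHom a (gnsVec τ 1) := by
  change _ = τ.gnsNonUnitalStarAlgHom a ((τ.toPreGNS 1 : τ.PreGNS) : τ.GNS)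
  rw [PositiveLinearMap.gnsNonUnitalStarAlgHom_apply_coe]
  simp [gnsVec]

/-- The orthogonal projection `P n` of the GNS space onto `H n = η (S n)`.  (The closure changes
nothing when `S n` is finite-dimensional.) -/
def levelProj (τ : A →ₚ[ℂ] ℂ) (S : ℕ → StarSubalgebra ℂ A) (n : ℕ) : τ.GNS →L[ℂ] τ.GNS :=
  ((S n).toSubalgebra.toSubmodule.map (gnsVec τ)).topologicalClosure.starProjection

/-- The projections `Q 0 = P 0` and `Q n = P n - P (n - 1)` for `n ≥ 1`. -/
def diffProj (τ : A →ₚ[ℂ] ℂ) (S : ℕ → StarSubalgebra ℂ A) : ℕ → τ.GNS →L[ℂ] τ.GNS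
  | 0 => levelProj τ S 0
  | n + 1 => levelProj τ S (n + 1) - levelProj τ S n

/-- The Dirac operator `D = ∑_{n ≥ 1} α n • Q n` on the GNS space of `τ`. -/
def dirac (τ : A →ₚ[ℂ] ℂ) (S : ℕ → StarSubalgebra ℂ A) (α : ℕ → ℝ) : τ.GNS →ₗ.[ℂ] τ.GNS :=
  seriesOp (diffProj τ S) α

end UHF

end UHFTriple

end

/-! A unital embedding of M_k into M_n forces k to divide n, so strictly increasing sizes at least
double and m_n ≥ 2^n. Each S n has exactly one normalised trace. Weak-* compactness turns
Hahn–Banach extensions of these traces into a tracial state of A, and density of the union makes it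
unique.

The projections Q_n, including Q_0, form an orthogonal resolution of the identity with
finite-dimensional ranges, so D is a diagonal operator. Its self-adjointness, the inverse of I + D²
and the compactness and trace of powers of that inverse are read off from coordinates. An element of
S k commutes with Q_n for n > k, so its commutator with D is a finite sum; hence the commutator
condition holds on a dense set.

The metric is governed by one estimate. The vector ξ = η(1) lies in the range of Q_0, so Dξ = 0 and
[D,a]ξ = Dη(a). If ‖[D,a]‖ ≤ 1, then ‖Q_n η(a)‖ ≤ |α_n|⁻¹. On S n the C*-norm is at most √m_n times
the GNS norm, because an operator norm is bounded by the Hilbert–Schmidt norm. So the elements c_n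
of S n with η(c_n) = P_n η(a) have increments of norm at most |α_n|⁻¹√m_n. If these numbers are
summable, c_n converges in norm, to a since τ is faithful, at a rate independent of a. As c_0 is
scalar, the Lipschitz ball is totally bounded modulo scalars, which is the criterion
`inducesWeakStarMetric_of_totallyBounded`. The main lemmas are `mem_graph_iff`,
`norm_diffProj_gnsVec_le` and `exists_approx`. Summability of the module follows from rank Q_n ≤
m_n². -/

noncomputable section

namespace UHFTriple

open Filter Topology

/-! ### Diagonal operators for an orthogonal resolution of the identity. -/

section Resolution

variable {H : Type*} [NormedAddCommGroup H] [InnerProductSpace ℂ H]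

/-- A sequence of mutually orthogonal projections whose sum converges strongly to the identity. -/
structure IsResolution [CompleteSpace H] (Q : ℕ → H →L[ℂ] H) : Prop where
  isSelfAdjoint : ∀ n, IsSelfAdjoint (Q n)
  mul_eq : ∀ i j, Q i * Q j = if i = j then Q i else 0
  tendsto : ∀ x, Tendsto (fun N => ∑ i ∈ Finset.range N, Q i x) atTop (𝓝 x)

variable [CompleteSpace H] {Q : ℕ → H →L[ℂ] H}

namespace IsResolution

theorem apply_apply (hQ : IsResolution Q) (i j : ℕ) (x : H) :
    Q i (Q j x) = if i = j then Q i x else 0 := by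
  have := congrArg (fun T : H →L[ℂ] H => T x) (hQ.mul_eq i j)
  split_ifs with h <;> simpa [h] using this

theorem apply_self (hQ : IsResolution Q) (i : ℕ) (x : H) : Q i (Q i x) = Q i x := by
  simp [hQ.apply_apply]

theorem inner_comm (hQ : IsResolution Q) (i : ℕ) (x y : H) :
    ⟪Q i x, y⟫_ℂ = ⟪x, Q i y⟫_ℂ :=
  (hQ.isSelfAdjoint i).isSymmetric x y

theorem inner_apply_self (hQ : IsResolution Q) (i : ℕ) (x : H) :
    ⟪x, Q i x⟫_ℂ = ((‖Q i x‖ ^ 2 : ℝ) : ℂ) := by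
  rw [← hQ.apply_self i x, ← hQ.inner_comm, hQ.apply_self, inner_self_eq_norm_sq_to_K]
  norm_cast

theorem ext (hQ : IsResolution Q) {x y : H} (h : ∀ n, Q n x = Q n y) : x = y := by
  refine tendsto_nhds_unique (hQ.tendsto x) ?_
  simpa only [h] using hQ.tendsto y

theorem orthogonalFamily (hQ : IsResolution Q) :
    OrthogonalFamily ℂ (fun i => (Q i).range) fun i => (Q i).range.subtypeₗᵢ := by
  rintro i j hij ⟨_, x, rfl⟩ ⟨_, y, rfl⟩
  simp [hQ.inner_comm, hQ.apply_apply, hij]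

theorem hasSum_norm_sq (hQ : IsResolution Q) (x : H) :
    HasSum (fun i => ‖Q i x‖ ^ 2) (‖x‖ ^ 2) := by
  rw [hasSum_iff_tendsto_nat_of_nonneg (fun i => by positivity)]
  refine ((hQ.tendsto x).norm.pow 2).congr fun N => ?_
  exact hQ.orthogonalFamily.norm_sum (fun i => ⟨Q i x, x, rfl⟩) _

theorem summable_iff (hQ : IsResolution Q) {y : ℕ → H} (hy : ∀ i, Q i (y i) = y i) :
    Summable y ↔ Summable fun i => ‖y i‖ ^ 2 :=
  hQ.orthogonalFamily.summable_iff_norm_sq_summable fun i => ⟨y i, y i, hy i⟩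

theorem hasSum (hQ : IsResolution Q) (x : H) : HasSum (fun i => Q i x) x := by
  have h : Summable fun i => Q i x :=
    (hQ.summable_iff fun i => hQ.apply_self i x).2 (hQ.hasSum_norm_sq x).summable
  have := h.hasSum
  rwa [tendsto_nhds_unique this.tendsto_sum_nat (hQ.tendsto x)] at this

theorem apply_tsum (hQ : IsResolution Q) {y : ℕ → H} (hy : ∀ i, Q i (y i) = y i)
    (h : Summable y) (n : ℕ) : Q n (∑' i, y i) = y n := by
  rw [(Q n).map_tsum h, tsum_eq_single n, hy]
  intro i hi
  rw [← hy i, hQ.apply_apply, if_neg hi.symm]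

theorem norm_apply_le (hQ : IsResolution Q) (n : ℕ) (x : H) : ‖Q n x‖ ≤ ‖x‖ := by
  have := (hQ.hasSum_norm_sq x).summable.le_tsum n fun i _ => by positivity
  rw [(hQ.hasSum_norm_sq x).tsum_eq] at this
  exact (sq_le_sq₀ (norm_nonneg _) (norm_nonneg _)).1 this

/-- A bounded operator which acts by bounded scalars on the ranges of the projections. -/
theorem norm_le_of_diag (hQ : IsResolution Q) {T : H →L[ℂ] H} {f : ℕ → ℝ} {C : ℝ} (hC : 0 ≤ C)
    (hf : ∀ n, |f n| ≤ C) (hT : ∀ n x, Q n (T x) = (f n : ℂ) • Q n x) : ‖T‖ ≤ C := by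
  refine T.opNorm_le_bound hC fun x => ?_
  rw [← sq_le_sq₀ (norm_nonneg _) (by positivity), mul_pow]
  refine hasSum_le (fun n => ?_) (hQ.hasSum_norm_sq (T x)) ((hQ.hasSum_norm_sq x).mul_left (C ^ 2))
  rw [hT, norm_smul, mul_pow, Complex.norm_real, Real.norm_eq_abs]
  gcongr
  exact hf n

theorem exists_diag (hQ : IsResolution Q) {f : ℕ → ℝ} {C : ℝ} (hf : ∀ n, |f n| ≤ C) :
    ∃ T : H →L[ℂ] H, ∀ n x, Q n (T x) = (f n : ℂ) • Q n x := by
  have hC : 0 ≤ C := (abs_nonneg _).trans (hf 0)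
  have hfix : ∀ x i, Q i ((f i : ℂ) • Q i x) = (f i : ℂ) • Q i x := fun x i => by
    rw [map_smul, hQ.apply_self]
  have hsum : ∀ x, Summable fun i => (f i : ℂ) • Q i x := fun x => by
    refine (hQ.summable_iff (hfix x)).2
      (((hQ.hasSum_norm_sq x).summable.mul_left (C ^ 2)).of_nonneg_of_le (fun i => by positivity)
        fun i => ?_)
    rw [norm_smul, mul_pow, Complex.norm_real, Real.norm_eq_abs]
    gcongr
    exact hf i
  have hap : ∀ x n, Q n (∑' i, (f i : ℂ) • Q i x) = (f n : ℂ) • Q n x := fun x n =>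
    hQ.apply_tsum (hfix x) (hsum x) n
  let T : H →ₗ[ℂ] H :=
    { toFun := fun x => ∑' i, (f i : ℂ) • Q i x
      map_add' := fun x y => hQ.ext fun n => by
        rw [hap, map_add, map_add, hap, hap, smul_add]
      map_smul' := fun c x => hQ.ext fun n => by
        rw [hap, map_smul, RingHom.id_apply, map_smul, hap, smul_comm c] }
  refine ⟨T.mkContinuous C fun x => ?_, fun n x => hap x n⟩
  rw [← sq_le_sq₀ (norm_nonneg _) (by positivity), mul_pow]
  refine hasSum_le (fun n => ?_) (hQ.hasSum_norm_sq (T x)) ((hQ.hasSum_norm_sq x).mul_left (C ^ 2))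
  rw [show Q n (T x) = _ from hap x n, norm_smul, mul_pow, Complex.norm_real, Real.norm_eq_abs]
  gcongr
  exact hf n

end IsResolution

omit [CompleteSpace H] in
theorem isCompactOperator_of_finiteDimensional_range {T : H →L[ℂ] H}
    [FiniteDimensional ℂ T.range] : IsCompactOperator T := by
  have h : IsCompactOperator (id : T.range → T.range) :=
    (isCompactOperator_id_iff_finiteDimensional (𝕜 := ℂ)).2 inferInstance
  exact (h.comp_clm (T.codRestrict T.range fun x => ⟨x, rfl⟩)).clm_comp T.range.subtypeL

/-- Truncations have finite rank and converge in norm, the error being the supremum of the tail of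
|f|. -/
theorem IsResolution.isCompactOperator_of_diag (hQ : IsResolution Q)
    (hfin : ∀ n, FiniteDimensional ℂ (Q n).range) {T : H →L[ℂ] H} {f : ℕ → ℝ}
    (hf : Tendsto f atTop (𝓝 0)) (hT : ∀ n x, Q n (T x) = (f n : ℂ) • Q n x) :
    IsCompactOperator T := by
  refine isCompactOperator_of_tendsto
    (F := fun N => ∑ i ∈ Finset.range N, (f i : ℂ) • Q i) (l := atTop) ?_ ?_
  · rw [Metric.tendsto_atTop]
    intro ε hε
    obtain ⟨N, hN⟩ := Metric.tendsto_atTop.1 hf (ε / 2) (by positivity)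
    refine ⟨N, fun n hn => ?_⟩
    rw [dist_comm, dist_eq_norm]
    refine lt_of_le_of_lt (hQ.norm_le_of_diag (f := fun i => if i < n then 0 else f i)
      (C := ε / 2) (by positivity) ?_ ?_) (by linarith)
    · intro i
      split_ifs with h
      · simpa using (half_pos hε).le
      · simpa using (hN i (by omega)).le
    · intro i x
      rw [sub_apply, map_sub, hT, sum_apply, map_sum]
      simp only [smul_apply, map_smul, hQ.apply_apply, smul_ite, smul_zero,
        Finset.sum_ite_eq, Finset.mem_range]
      split_ifs <;> simp
  · refine Eventually.of_forall fun N => ?_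
    have : ∀ s : Finset ℕ, IsCompactOperator (∑ i ∈ s, (f i : ℂ) • Q i : H →L[ℂ] H) := by
      intro s
      induction s using Finset.induction_on with
      | empty => simpa using isCompactOperator_zero
      | insert a s ha ih =>
        rw [Finset.sum_insert ha]
        have := hfin a
        exact ((isCompactOperator_of_finiteDimensional_range (T := Q a)).smul (f a : ℂ)).add ih
    exact this _

/-! ### The unbounded operator -/

/-- The sequence `α` with its value at `0` replaced by `0`. -/
def dropZero (α : ℕ → ℝ) : ℕ → ℝ
  | 0 => 0
  | n + 1 => α (n + 1)

/-- This reduces every question about the unbounded operator to coordinates. No separate convergence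
check is needed in the reverse direction: the series in question is the expansion of y. -/
theorem IsResolution.mem_graph_iff (hQ : IsResolution Q) {α : ℕ → ℝ} {x y : H} :
    (∃ h : x ∈ (seriesOp Q α).domain, seriesOp Q α ⟨x, h⟩ = y) ↔
      ∀ n, Q n y = (dropZero α n : ℂ) • Q n x := by
  have hfix : ∀ i, Q i ((dropZero α i : ℂ) • Q i x) = (dropZero α i : ℂ) • Q i x := fun i => by
    rw [map_smul, hQ.apply_self]
  have hdom : x ∈ (seriesOp Q α).domain ↔ Summable fun i => (dropZero α i : ℂ) • Q i x :=
    summable_nat_add_iff (f := fun i => (dropZero α i : ℂ) • Q i x) 1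
  have hval : ∀ h : x ∈ (seriesOp Q α).domain,
      seriesOp Q α ⟨x, h⟩ = ∑' i, (dropZero α i : ℂ) • Q i x := fun h => by
    rw [(hdom.1 h).tsum_eq_zero_add]
    simp only [dropZero, Complex.ofReal_zero, zero_smul, zero_add]
    rfl
  constructor
  · rintro ⟨h, rfl⟩ n
    rw [hval h]
    exact hQ.apply_tsum hfix (hdom.1 h) n
  · intro h
    have hs : HasSum (fun i => (dropZero α i : ℂ) • Q i x) y := by
      simpa only [h] using hQ.hasSum y
    have hx := hdom.2 hs.summable
    exact ⟨hx, (hval hx).trans hs.tsum_eq⟩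

theorem IsResolution.apply_seriesOp (hQ : IsResolution Q) {α : ℕ → ℝ}
    (x : (seriesOp Q α).domain) (n : ℕ) :
    Q n (seriesOp Q α x) = (dropZero α n : ℂ) • Q n (x : H) :=
  hQ.mem_graph_iff.1 ⟨x.2, rfl⟩ n

theorem IsResolution.apply_mem_graph (hQ : IsResolution Q) (α : ℕ → ℝ) (k : ℕ) (x : H) :
    ∃ h : Q k x ∈ (seriesOp Q α).domain,
      seriesOp Q α ⟨Q k x, h⟩ = (dropZero α k : ℂ) • Q k x := by
  rw [hQ.mem_graph_iff]
  intro n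
  rw [map_smul, hQ.apply_apply]
  split_ifs with h <;> simp [h]

theorem IsResolution.isSelfAdjoint_seriesOp (hQ : IsResolution Q) (α : ℕ → ℝ) :
    IsSelfAdjoint (seriesOp Q α) := by
  have hdense : Dense ((seriesOp Q α).domain : Set H) := fun x => by
    refine mem_closure_of_tendsto (hQ.tendsto x) (Eventually.of_forall fun N => ?_)
    exact Submodule.sum_mem _ fun i _ => (hQ.apply_mem_graph α i x).1
  have hformal : (seriesOp Q α).IsFormalAdjoint (seriesOp Q α) := fun x y => by
    have h₁ := (hQ.hasSum (y : H)).mapL (innerSL ℂ (seriesOp Q α x))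
    have h₂ := (hQ.hasSum (seriesOp Q α y)).mapL (innerSL ℂ (x : H))
    refine h₁.unique (h₂.congr_fun fun n => ?_)
    simp only [innerSL_apply_apply]
    rw [hQ.apply_seriesOp, ← hQ.inner_comm, hQ.apply_seriesOp, inner_smul_left, inner_smul_right,
      hQ.inner_comm]
    simp
  rw [LinearPMap.isSelfAdjoint_def]
  symm
  have hle := hformal.le_adjoint hdense
  refine LinearPMap.eq_of_le_of_domain_eq hle (le_antisymm hle.1 fun y hy => ?_)
  -- Testing the adjoint relation on vectors Q n x, which always lie in the domain, determines the
  -- coordinates of D* y; the graph criterion then puts y in the domain of D.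
  refine (hQ.mem_graph_iff (y := (seriesOp Q α).adjoint ⟨y, hy⟩)).2 (fun n => ?_) |>.1
  refine ext_inner_right ℂ fun x => ?_
  obtain ⟨h, hx⟩ := hQ.apply_mem_graph α n x
  have := LinearPMap.adjoint_isFormalAdjoint hdense ⟨y, hy⟩ ⟨Q n x, h⟩
  rw [hx] at this
  rw [hQ.inner_comm, this, inner_smul_right, inner_smul_left, hQ.inner_comm]
  simp

theorem IsResolution.exists_inverse (hQ : IsResolution Q) (α : ℕ → ℝ) :
    ∃ R : H →L[ℂ] H, IsInverseOneAddSq (seriesOp Q α) R ∧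
      ∀ n x, Q n (R x) = (((1 + dropZero α n ^ 2)⁻¹ : ℝ) : ℂ) • Q n x := by
  have hpos : ∀ n, (0 : ℝ) < 1 + dropZero α n ^ 2 := fun n => by positivity
  obtain ⟨R, hR⟩ := hQ.exists_diag (f := fun n => (1 + dropZero α n ^ 2)⁻¹) (C := 1) fun n => by
    rw [abs_of_pos (inv_pos.2 (hpos n))]
    exact inv_le_one_of_one_le₀ (by nlinarith [sq_nonneg (dropZero α n)])
  have hle : ∀ n, |dropZero α n * (1 + dropZero α n ^ 2)⁻¹| ≤ 1 := fun n => by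
    rw [abs_mul, abs_of_pos (inv_pos.2 (hpos n)), ← div_eq_mul_inv, div_le_one (hpos n),
      ← sq_abs (dropZero α n)]
    nlinarith [sq_nonneg (|dropZero α n| - 1)]
  -- B plays the role of D R, so that D B = I - R.
  obtain ⟨B, hB⟩ := hQ.exists_diag hle
  have hne : ∀ n, (1 : ℂ) + (dropZero α n : ℂ) ^ 2 ≠ 0 := fun n => by
    exact_mod_cast (hpos n).ne'
  refine ⟨R, ⟨fun y => ?_, fun x h₁ h₂ => hQ.ext fun n => ?_⟩, hR⟩
  · obtain ⟨h₁, e₁⟩ : ∃ h, seriesOp Q α ⟨R y, h⟩ = B y := hQ.mem_graph_iff.2 fun n => by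
      rw [hR, hB, smul_smul]; push_cast; rfl
    obtain ⟨h₂, e₂⟩ : ∃ h, seriesOp Q α ⟨B y, h⟩ = y - R y := hQ.mem_graph_iff.2 fun n => by
      rw [map_sub, hR, hB, smul_smul]
      nth_rewrite 1 [← one_smul ℂ (Q n y)]
      rw [← sub_smul]
      congr 1
      push_cast
      field_simp [hne n]
      ring
    refine ⟨h₁, by rwa [e₁], ?_⟩
    simp only [e₁, e₂]
    abel
  · rw [hR, map_add, hQ.apply_seriesOp, hQ.apply_seriesOp, smul_smul]
    nth_rewrite 1 [← one_smul ℂ (Q n x)]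
    rw [← add_smul, smul_smul]
    nth_rewrite 2 [← one_smul ℂ (Q n x)]
    congr 1
    push_cast
    field_simp [hne n]

/-! ### Powers and traces -/

/-- The continuous functional calculus acts on eigenvectors by the values of the function. -/
theorem cfc_apply_of_eigenvector {a : H →L[ℂ] H} (ha : IsSelfAdjoint a) {x : H} {t : ℝ}
    (hx : a x = (t : ℂ) • x) {g : ℝ → ℝ} (hg : ContinuousOn g (spectrum ℝ a)) :
    cfc g a x = (g t : ℂ) • x := by
  rcases eq_or_ne x 0 with rfl | hx0
  · simp
  have ht : t ∈ spectrum ℝ a := by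
    intro hu
    obtain ⟨u, hu⟩ := hu
    refine hx0 ?_
    have h0 : (u : H →L[ℂ] H) x = 0 := by
      rw [hu, sub_apply, hx, Algebra.algebraMap_eq_smul_one]
      simp
    calc x = ((↑u⁻¹ * ↑u : H →L[ℂ] H)) x := by simp
      _ = 0 := by rw [mul_apply_eq_comp, h0, map_zero]
  rw [cfc_apply g a ha hg]
  -- Functions with this property form a closed subalgebra containing the constants and the
  -- identity, so Stone–Weierstrass applies.
  suffices ∀ f : C(spectrum ℝ a, ℝ), cfcHom ha f x = ((f ⟨t, ht⟩ : ℝ) : ℂ) • x from this _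
  intro f
  induction f using ContinuousMap.induction_on_of_compact with
  | const r =>
    rw [show ContinuousMap.const _ r = algebraMap ℝ C(spectrum ℝ a, ℝ) r from rfl,
      AlgHomClass.commutes, Algebra.algebraMap_eq_smul_one]
    simp
  | id => rw [cfcHom_id ha]; simpa using hx
  | star_id => rw [star_trivial, cfcHom_id ha]; simpa using hx
  | add f g hf hg => simp [hf, hg, add_smul]
  | mul f g hf hg => rw [map_mul, mul_apply_eq_comp, hg, map_smul, hf, smul_smul, mul_comm]; simp
  | frequently f hf =>
    have hc : Continuous fun f : C(spectrum ℝ a, ℝ) => cfcHom ha f x :=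
      (ContinuousLinearMap.apply ℂ H x).continuous.comp (cfcHom_continuous ha)
    have hd : Continuous fun f : C(spectrum ℝ a, ℝ) => ((f ⟨t, ht⟩ : ℝ) : ℂ) • x :=
      (Complex.continuous_ofReal.comp (continuous_eval_const _)).smul
        continuous_const
    exact (isClosed_eq hc hd).mem_of_frequently_of_tendsto hf tendsto_id

/-- Expand in an orthonormal basis of the range, exchange the sums, and apply Bessel's inequality to
each basis vector. -/
theorem IsResolution.sum_norm_sq_le_finrank (hQ : IsResolution Q) (n : ℕ)
    [FiniteDimensional ℂ (Q n).range] {ι : Type*} {e : ι → H} (he : Orthonormal ℂ e)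
    (s : Finset ι) : ∑ i ∈ s, ‖Q n (e i)‖ ^ 2 ≤ Module.finrank ℂ (Q n).range := by
  let v := stdOrthonormalBasis ℂ (Q n).range
  have hv : ∀ j, Q n (v j : H) = v j := fun j => by
    obtain ⟨z, hz⟩ := (v j).2
    rw [← hz]
    exact hQ.apply_self n z
  have h₁ : ∀ i, ‖Q n (e i)‖ ^ 2 = ∑ j, ‖⟪e i, (v j : H)⟫_ℂ‖ ^ 2 := fun i => by
    have := v.sum_sq_norm_inner_left (⟨Q n (e i), e i, rfl⟩ : (Q n).range)
    rw [show ‖Q n (e i)‖ = ‖(⟨Q n (e i), e i, rfl⟩ : (Q n).range)‖ from rfl, ← this]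
    refine Finset.sum_congr rfl fun j _ => ?_
    rw [Submodule.coe_inner, hQ.inner_comm, hv]
  simp only [h₁]
  rw [Finset.sum_comm]
  refine (Finset.sum_le_sum fun j _ => he.sum_inner_products_le (v j : H) (s := s)).trans ?_
  have : ∀ j, ‖(v j : H)‖ = 1 := fun j => v.orthonormal.1 j
  simp [this]

theorem IsResolution.hasFiniteTrace_rpow (hQ : IsResolution Q)
    (hfin : ∀ n, FiniteDimensional ℂ (Q n).range) {R : H →L[ℂ] H} {f : ℕ → ℝ} {q : ℝ}
    (hq : 0 ≤ q) (hf : ∀ n, 0 ≤ f n) (hR : ∀ n x, Q n (R x) = (f n : ℂ) • Q n x)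
    (hsum : Summable fun n => f n ^ q * Module.finrank ℂ (Q n).range) :
    HasFiniteTrace (CFC.rpow R q) := by
  have hRQ : ∀ n x, R (Q n x) = (f n : ℂ) • Q n x := fun n x => hQ.ext fun k => by
    rw [hR, map_smul, hQ.apply_apply]
    split_ifs with h <;> simp [h]
  have hR0 : 0 ≤ R := by
    rw [ContinuousLinearMap.nonneg_iff_isPositive, ContinuousLinearMap.isPositive_iff_complex]
    intro x
    have h : 0 ≤ ⟪R x, x⟫_ℂ := by
      refine ((hQ.hasSum x).mapL (innerSL ℂ (R x))).nonneg fun n => ?_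
      rw [innerSL_apply_apply, ← hQ.inner_comm, hR, inner_smul_left, hQ.inner_comm,
        hQ.inner_apply_self, Complex.conj_ofReal, ← Complex.ofReal_mul]
      exact Complex.zero_le_real.2 (mul_nonneg (hf n) (by positivity))
    exact ⟨RCLike.ext (by simp) (by simpa using (RCLike.nonneg_iff.1 h).2.symm),
      (RCLike.nonneg_iff.1 h).1⟩
  have hT : ∀ n x, CFC.rpow R q (Q n x) = ((f n ^ q : ℝ) : ℂ) • Q n x := fun n x => by
    have : CFC.rpow R q = cfc (fun x : ℝ => x ^ q) R := CFC.rpow_eq_cfc_real hR0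
    rw [this]
    exact cfc_apply_of_eigenvector hR0.isSelfAdjoint (hRQ n x)
      (Real.continuous_rpow_const hq).continuousOn
  have hinnerT : ∀ x, HasSum (fun n => f n ^ q * ‖Q n x‖ ^ 2) (⟪x, CFC.rpow R q x⟫_ℂ).re := by
    intro x
    have := ((hQ.hasSum x).mapL (CFC.rpow R q)).mapL (innerSL ℂ x)
    refine (Complex.hasSum_re this).congr_fun fun n => ?_
    rw [innerSL_apply_apply, hT, inner_smul_right, hQ.inner_apply_self, ← Complex.ofReal_mul,
      Complex.ofReal_re]
  refine ⟨(ContinuousLinearMap.nonneg_iff_isPositive _).1 CFC.rpow_nonneg, fun s e => ?_⟩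
  have h0 : ∀ n, 0 ≤ f n ^ q := fun n => Real.rpow_nonneg (hf n) q
  refine summable_of_sum_le (c := ∑' n, f n ^ q * Module.finrank ℂ (Q n).range)
    (fun i => (hinnerT (e i)).nonneg fun n => mul_nonneg (h0 n) (by positivity)) fun u => ?_
  refine hasSum_le (fun n => ?_) (hasSum_sum fun i (_ : i ∈ u) => hinnerT (e i)) hsum.hasSum
  rw [← Finset.mul_sum]
  have := hfin n
  exact mul_le_mul_of_nonneg_left (hQ.sum_norm_sq_le_finrank n e.orthonormal u) (h0 n)

end Resolution

/-! ### A total boundedness criterion for the weak-* topology. -/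

section Metric

variable {A : Type*} [CStarAlgebra A] [PartialOrder A] [StarOrderedRing A]

/-- Cauchy–Schwarz in the pre-GNS space, against the unit vector coming from 1. -/
theorem norm_apply_le_of_map_one (f : A →ₚ[ℂ] ℂ) (hf : f 1 = 1) (a : A) : ‖f a‖ ≤ ‖a‖ := by
  have h₁ : f a = ⟪f.toPreGNS 1, f.toPreGNS a⟫_ℂ := by simp [PositiveLinearMap.preGNS_inner_def]
  have h₂ : ‖f.toPreGNS 1‖ = 1 := by simp [PositiveLinearMap.preGNS_norm_def, hf]
  have h₃ : ‖f.toPreGNS a‖ ≤ ‖a‖ := by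
    rw [PositiveLinearMap.preGNS_norm_def]
    refine Real.sqrt_le_iff.2 ⟨norm_nonneg _, ?_⟩
    refine (Complex.re_le_norm _).trans
      ((f.norm_apply_le_of_nonneg _ (star_mul_self_nonneg _)).trans ?_)
    simp [hf, CStarRing.norm_star_mul_self, sq]
  rw [h₁]
  exact (norm_inner_le_norm _ _).trans (by rw [h₂, one_mul]; exact h₃)

/-- A state, as a positive linear map. -/
def stateToPositive (φ : stateSpace A) : A →ₚ[ℂ] ℂ :=
  PositiveLinearMap.mk₀ (φ.1 : A →ₗ[ℂ] ℂ) fun x hx => by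
    obtain ⟨b, rfl⟩ := CStarAlgebra.nonneg_iff_eq_star_mul_self.1 hx
    exact φ.2.2 b

theorem norm_state_apply_le (φ : stateSpace A) (a : A) : ‖φ.1 a‖ ≤ ‖a‖ :=
  norm_apply_le_of_map_one (stateToPositive φ) φ.2.1 a

theorem norm_state_sub_le (φ ψ : stateSpace A) (a b : A) (z : ℂ) :
    ‖φ.1 a - ψ.1 a‖ ≤ 2 * ‖a - algebraMap ℂ A z - b‖ + ‖φ.1 b - ψ.1 b‖ := by
  have hz : ∀ χ : stateSpace A, χ.1 (algebraMap ℂ A z) = z := fun χ => by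
    rw [Algebra.algebraMap_eq_smul_one, map_smul, χ.2.1]; simp
  have h : φ.1 a - ψ.1 a = φ.1 (a - algebraMap ℂ A z - b) - ψ.1 (a - algebraMap ℂ A z - b) +
      (φ.1 b - ψ.1 b) := by
    simp only [map_sub, hz]; ring
  rw [h]
  have h₁ := norm_state_apply_le φ (a - algebraMap ℂ A z - b)
  have h₂ := norm_state_apply_le ψ (a - algebraMap ℂ A z - b)
  refine (norm_add_le _ _).trans ?_
  have := norm_sub_le (φ.1 (a - algebraMap ℂ A z - b)) (ψ.1 (a - algebraMap ℂ A z - b))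
  linarith

variable {H : Type*} [NormedAddCommGroup H] [InnerProductSpace ℂ H] [CompleteSpace H]

omit [CompleteSpace H] in
theorem IsCommutator.smul {D : H →ₗ.[ℂ] H} {a T : H →L[ℂ] H} (h : IsCommutator D a T) (c : ℂ) :
    IsCommutator D (c • a) (c • T) := by
  obtain ⟨h₁, h₂⟩ := h
  refine ⟨fun x => D.domain.smul_mem c (h₁ x), fun x => ?_⟩
  have : D ⟨(c • a) x, D.domain.smul_mem c (h₁ x)⟩ = c • D ⟨a x, h₁ x⟩ :=
    D.map_smul c ⟨a x, h₁ x⟩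
  rw [this, smul_apply, smul_apply, ← h₂, smul_sub]

variable {π : A →⋆ₐ[ℂ] (H →L[ℂ] H)} {D : H →ₗ.[ℂ] H}

omit [PartialOrder A] [StarOrderedRing A] in
theorem ofReal_norm_sub_le_connesDist (φ ψ : stateSpace A) {a : A} {T : H →L[ℂ] H}
    (hT : IsCommutator D (π a) T) (h1 : ‖T‖ ≤ 1) :
    ENNReal.ofReal ‖φ.1 a - ψ.1 a‖ ≤ connesDist π D φ ψ :=
  le_iSup₂_of_le (f := fun a (_ : a ∈ {a : A | ∃ T : H →L[ℂ] H, IsCommutator D (π a) T ∧ ‖T‖ ≤ 1})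
    => ENNReal.ofReal ‖φ.1 a - ψ.1 a‖) a ⟨T, hT, h1⟩ le_rfl

-- Rescaling by ‖T‖ + 1 instead of ‖T‖ covers the case T = 0.
omit [PartialOrder A] [StarOrderedRing A] in
theorem ofReal_norm_sub_le_mul_connesDist (φ ψ : stateSpace A) {a : A} {T : H →L[ℂ] H}
    (hT : IsCommutator D (π a) T) :
    ENNReal.ofReal ‖φ.1 a - ψ.1 a‖ ≤ ENNReal.ofReal (‖T‖ + 1) * connesDist π D φ ψ := by
  have hpos : 0 < ‖T‖ + 1 := by positivity
  have h := ofReal_norm_sub_le_connesDist φ ψ (π := π) (D := D)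
    (a := (((‖T‖ + 1)⁻¹ : ℝ) : ℂ) • a) (T := (((‖T‖ + 1)⁻¹ : ℝ) : ℂ) • T)
    (by rw [map_smul]; exact hT.smul _) (by
      rw [norm_smul, Complex.norm_real, Real.norm_eq_abs, abs_of_pos (inv_pos.2 hpos),
        inv_mul_le_one₀ hpos]
      linarith)
  refine le_trans (le_of_eq ?_) (mul_le_mul_right h (ENNReal.ofReal (‖T‖ + 1)))
  rw [← ENNReal.ofReal_mul hpos.le, map_smul, map_smul, ← smul_sub, norm_smul, Complex.norm_real,
    Real.norm_eq_abs, abs_of_pos (inv_pos.2 hpos), mul_inv_cancel_left₀ hpos.ne']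

omit [PartialOrder A] [StarOrderedRing A] in
theorem connesDist_comm (φ ψ : stateSpace A) : connesDist π D φ ψ = connesDist π D ψ φ := by
  simp only [connesDist, norm_sub_rev]

omit [PartialOrder A] [StarOrderedRing A] in
theorem connesDist_self (φ : stateSpace A) : connesDist π D φ φ = 0 := by
  simp [connesDist]

omit [PartialOrder A] [StarOrderedRing A] in
theorem connesDist_triangle (φ ψ χ : stateSpace A) :
    connesDist π D φ χ ≤ connesDist π D φ ψ + connesDist π D ψ χ := by
  refine iSup₂_le fun a ⟨T, hT, h1⟩ => ?_
  refine le_trans ?_ (add_le_add (ofReal_norm_sub_le_connesDist φ ψ hT h1)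
    (ofReal_norm_sub_le_connesDist ψ χ hT h1))
  rw [← ENNReal.ofReal_add (norm_nonneg _) (norm_nonneg _)]
  exact ENNReal.ofReal_le_ofReal (norm_sub_le_norm_sub_add_norm_sub _ _ _)

omit [PartialOrder A] [StarOrderedRing A] in
theorem eq_of_connesDist_eq_zero (hd : Dense {a : A | ∃ T : H →L[ℂ] H, IsCommutator D (π a) T})
    {φ ψ : stateSpace A} (h : connesDist π D φ ψ = 0) : φ = ψ := by
  have : (fun a => φ.1 a) = fun a => ψ.1 a := by
    refine Continuous.ext_on hd (map_continuous φ.1) (map_continuous ψ.1) ?_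
    rintro a ⟨T, hT⟩
    have := ofReal_norm_sub_le_mul_connesDist φ ψ hT
    rw [h, mul_zero, nonpos_iff_eq_zero, ENNReal.ofReal_eq_zero] at this
    exact sub_eq_zero.1 (norm_le_zero_iff.1 this)
  exact Subtype.ext (DFunLike.coe_injective this)

/-- The distance `connesDist` induces the weak-* topology as soon as the elements with bounded
commutator are dense, and those with commutator of norm at most one form a totally bounded set
modulo the scalars. -/
theorem inducesWeakStarMetric_of_totallyBounded
    (hd : Dense {a : A | ∃ T : H →L[ℂ] H, IsCommutator D (π a) T})
    (htb : ∀ ε > 0, ∃ F : Set A, F.Finite ∧ ∀ (a : A) (T : H →L[ℂ] H), IsCommutator D (π a) T →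
      ‖T‖ ≤ 1 → ∃ b ∈ F, ∃ z : ℂ, ‖a - algebraMap ℂ A z - b‖ ≤ ε) :
    InducesWeakStarMetric π D := by
  have hfin : ∀ φ ψ : stateSpace A, connesDist π D φ ψ ≠ ⊤ := fun φ ψ => by
    obtain ⟨F, hF, h⟩ := htb 1 one_pos
    obtain ⟨C, hC⟩ := (hF.image fun b => ‖φ.1 b - ψ.1 b‖).bddAbove
    refine ne_top_of_le_ne_top (ENNReal.ofReal_ne_top (r := 2 + C)) (iSup₂_le ?_)
    rintro a ⟨T, hT, h1⟩
    obtain ⟨b, hb, z, hz⟩ := h a T hT h1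
    refine ENNReal.ofReal_le_ofReal ((norm_state_sub_le φ ψ a b z).trans ?_)
    have := hC ⟨b, hb, rfl⟩
    dsimp only at this
    linarith
  let d : MetricSpace (stateSpace A) :=
    { dist := fun φ ψ => (connesDist π D φ ψ).toReal
      dist_self := fun φ => by simp [connesDist_self]
      dist_comm := fun φ ψ => by rw [connesDist_comm]
      dist_triangle := fun φ ψ χ => by
        rw [← ENNReal.toReal_add (hfin _ _) (hfin _ _)]
        exact ENNReal.toReal_mono (ENNReal.add_ne_top.2 ⟨hfin _ _, hfin _ _⟩)
          (connesDist_triangle φ ψ χ)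
      eq_of_dist_eq_zero := fun {φ ψ} h => eq_of_connesDist_eq_zero hd
        (((ENNReal.toReal_eq_zero_iff _).1 h).resolve_right (hfin _ _)) }
  refine ⟨d, fun φ ψ => (ENNReal.ofReal_toReal (hfin φ ψ)).symm, le_antisymm ?_ ?_⟩
  -- Evaluations are d-continuous: approximate a by some a' with bounded commutator, where
  -- evaluation is Lipschitz for d.
  · have hmain : ∀ a : A, @Continuous _ _ d.toPseudoMetricSpace.toUniformSpace.toTopologicalSpace _
        fun φ : stateSpace A => φ.1 a := by
      intro a
      refine (@Metric.continuous_iff _ _ d.toPseudoMetricSpace _ _).2 fun φ ε hε => ?_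
      obtain ⟨a', ⟨T, hT⟩, ha'⟩ := Metric.mem_closure_iff.1 (hd a) (ε / 4) (by positivity)
      rw [dist_eq_norm] at ha'
      have hpos : 0 < ‖T‖ + 1 := by positivity
      refine ⟨ε / 2 / (‖T‖ + 1), by positivity, fun ψ hψ => ?_⟩
      have h₁ := norm_state_sub_le ψ φ a a' 0
      have h₂ : ‖ψ.1 a' - φ.1 a'‖ ≤ (‖T‖ + 1) * d.dist ψ φ := by
        have := ENNReal.toReal_mono (ENNReal.mul_ne_top ENNReal.ofReal_ne_top (hfin ψ φ))
          (ofReal_norm_sub_le_mul_connesDist ψ φ hT)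
        rwa [ENNReal.toReal_ofReal (norm_nonneg _), ENNReal.toReal_mul,
          ENNReal.toReal_ofReal hpos.le] at this
      have h₃ : (‖T‖ + 1) * d.dist ψ φ < ε / 2 := by
        rw [mul_comm]
        exact (lt_div_iff₀ hpos).1 hψ
      rw [map_zero, sub_zero] at h₁
      rw [dist_eq_norm]
      linarith
    rw [← continuous_id_iff_le]
    refine (@continuous_induced_rng _ _ _ _ _ _ (_)).2 ?_
    exact @WeakDual.continuous_of_continuous_eval _ _ _ _ _ _ _ _ _ _ (_) _ hmain
  · rw [← continuous_id_iff_le]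
    refine (@Metric.continuous_iff' _ _ d.toPseudoMetricSpace _ _).2 fun φ ε hε => ?_
    -- Conversely, closeness on a finite net controls the whole Lipschitz ball: 2 · ε/8 + ε/4 = ε/2.
    obtain ⟨F, hF, h⟩ := htb (ε / 8) (by positivity)
    have hev : ∀ᶠ ψ in 𝓝 φ, ∀ b ∈ F, ‖ψ.1 b - φ.1 b‖ < ε / 4 := by
      refine (eventually_all_finite hF).2 fun b _ => ?_
      have hc : Continuous fun ψ : stateSpace A => ψ.1 b :=
        (WeakDual.eval_continuous b).comp continuous_subtype_val
      have := Metric.continuous_iff'.1 hc φ (ε / 4) (by positivity)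
      simpa only [dist_eq_norm] using this
    filter_upwards [hev] with ψ hψ
    suffices connesDist π D ψ φ ≤ ENNReal.ofReal (ε / 2) by
      refine lt_of_le_of_lt (ENNReal.toReal_mono ENNReal.ofReal_ne_top this) ?_
      rw [ENNReal.toReal_ofReal (by positivity)]
      linarith
    refine iSup₂_le ?_
    rintro a ⟨T, hT, h1⟩
    obtain ⟨b, hb, z, hz⟩ := h a T hT h1
    refine ENNReal.ofReal_le_ofReal ((norm_state_sub_le ψ φ a b z).trans ?_)
    have := hψ b hb
    linarith

end Metric

/-! ### Traces and norms of matrices. -/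

section Matrix

open scoped Matrix Matrix.Norms.L2Operator

variable {n : Type*} [Fintype n] [DecidableEq n]

/-- Every normalized tracial functional on a matrix algebra is the normalized trace. -/
theorem card_mul_eq_trace (f : Matrix n n ℂ →ₗ[ℂ] ℂ) (h1 : f 1 = 1)
    (hf : ∀ M N, f (M * N) = f (N * M)) (M : Matrix n n ℂ) :
    (Fintype.card n : ℂ) * f M = M.trace := by
  have hoff : ∀ i j, i ≠ j → f (Matrix.single i j 1) = 0 := fun i j hij => by
    have := hf (Matrix.single i i 1) (Matrix.single i j 1)
    rwa [Matrix.single_mul_single_same, one_mul, Matrix.single_mul_single_of_ne (h := hij.symm),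
      map_zero] at this
  have hdiag : ∀ i j, f (Matrix.single i i 1) = f (Matrix.single j j 1) := fun i j => by
    have := hf (Matrix.single i j 1) (Matrix.single j i 1)
    rwa [Matrix.single_mul_single_same, Matrix.single_mul_single_same, one_mul] at this
  have hM : ∀ M : Matrix n n ℂ, f M = ∑ i, M i i * f (Matrix.single i i 1) := fun M => by
    conv_lhs => rw [Matrix.matrix_eq_sum_single M]
    simp only [map_sum]
    refine Finset.sum_congr rfl fun i _ => ?_
    have hs : ∀ j, f (Matrix.single i j (M i j)) = M i j * f (Matrix.single i j 1) := fun j => by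
      rw [← smul_eq_mul, ← map_smul, Matrix.smul_single, smul_eq_mul, mul_one]
    rw [Finset.sum_eq_single i, hs]
    · intro j _ hj
      rw [hs, hoff i j hj.symm, mul_zero]
    · simp
  rcases isEmpty_or_nonempty n with h | ⟨⟨k⟩⟩
  · simp
  have hMk : ∀ M : Matrix n n ℂ, f M = M.trace * f (Matrix.single k k 1) := fun M => by
    rw [hM, Matrix.trace, Finset.sum_mul]
    exact Finset.sum_congr rfl fun i _ => by rw [hdiag i k]; rfl
  have hk := hMk 1
  rw [h1, Matrix.trace_one] at hk
  rw [hMk M, mul_left_comm, ← hk, mul_one]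

/-- The Hilbert–Schmidt norm dominates the operator norm, by Cauchy–Schwarz in each row. After
normalising the trace this produces the factor √m_n. -/
theorem norm_sq_le_trace (M : Matrix n n ℂ) : ‖M‖ ^ 2 ≤ (Mᴴ * M).trace.re := by
  have htr : (Mᴴ * M).trace.re = ∑ i, ∑ j, ‖M i j‖ ^ 2 := by
    rw [Finset.sum_comm, Matrix.trace, Complex.re_sum]
    refine Finset.sum_congr rfl fun j _ => ?_
    rw [Matrix.diag_apply, Matrix.mul_apply, Complex.re_sum]
    refine Finset.sum_congr rfl fun i _ => ?_
    rw [Matrix.conjTranspose_apply, RCLike.star_def, ← Complex.normSq_eq_conj_mul_self,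
      Complex.ofReal_re, Complex.normSq_eq_norm_sq]
  rw [htr]
  have h0 : 0 ≤ ∑ i, ∑ j, ‖M i j‖ ^ 2 := by positivity
  refine (Real.le_sqrt (norm_nonneg _) h0).1 ?_
  rw [Matrix.cstar_norm_def]
  refine ContinuousLinearMap.opNorm_le_bound _ (Real.sqrt_nonneg _) fun x => ?_
  rw [← Real.sqrt_sq (norm_nonneg x), ← Real.sqrt_mul h0]
  refine Real.le_sqrt_of_sq_le ?_
  rw [EuclideanSpace.norm_sq_eq, EuclideanSpace.norm_sq_eq, Finset.sum_mul]
  refine Finset.sum_le_sum fun i _ => ?_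
  refine le_trans ?_ (Finset.sum_mul_sq_le_sq_mul_sq _ (fun j => ‖M i j‖) fun j => ‖x j‖)
  rw [Matrix.ofLp_toEuclideanCLM, Matrix.mulVec, dotProduct]
  gcongr
  exact (norm_sum_le _ _).trans (le_of_eq (by simp))

theorem norm_trace_le (M : Matrix n n ℂ) : ‖M.trace‖ ≤ Fintype.card n * ‖M‖ := by
  refine (norm_sum_le _ _).trans ?_
  have : ∀ i, ‖M i i‖ ≤ ‖M‖ := fun i => by
    have h₁ := (Matrix.toEuclideanCLM (n := n) (𝕜 := ℂ) M).le_opNorm (PiLp.single 2 i 1)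
    rw [PiLp.norm_single, norm_one, mul_one, ← Matrix.cstar_norm_def] at h₁
    refine le_trans (le_of_eq ?_) ((PiLp.norm_apply_le _ i).trans h₁)
    rw [Matrix.ofLp_toEuclideanCLM]
    simp
  exact (Finset.sum_le_card_nsmul _ _ _ fun i _ => this i).trans (by simp)

/-- The trace of an idempotent is its rank. -/
theorem exists_trace_eq_natCast {M : Matrix n n ℂ} (hM : IsIdempotentElem M) :
    ∃ r : ℕ, M.trace = r := by
  have h : IsIdempotentElem (Matrix.toLin' M) := by
    rw [IsIdempotentElem, Module.End.mul_eq_comp, ← Matrix.toLin'_mul, hM.eq]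
  have := ((LinearMap.isProj_range_iff_isIdempotentElem _).2 h).trace
  rw [Matrix.trace_toLin'_eq] at this
  exact ⟨_, this⟩

/-- A unital embedding of matrix algebras exists only if the size of the first divides the size of
the second. -/
theorem card_dvd_card_of_algHom {k : Type*} [Fintype k] [DecidableEq k] [Nonempty k] [Nonempty n]
    (ψ : Matrix k k ℂ →ₐ[ℂ] Matrix n n ℂ) : Fintype.card k ∣ Fintype.card n := by
  obtain ⟨i⟩ := ‹Nonempty k›
  have hn : (Fintype.card n : ℂ) ≠ 0 := by exact_mod_cast Fintype.card_ne_zero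
  -- The pulled-back normalised trace must be the normalised trace of M_k. On a diagonal matrix unit
  -- it is 1/k, and also r/n with r the rank of the image; hence k r = n.
  let f : Matrix k k ℂ →ₗ[ℂ] ℂ :=
    (Fintype.card n : ℂ)⁻¹ • (Matrix.traceLinearMap n ℂ ℂ ∘ₗ ψ.toLinearMap)
  have hf : ∀ M, f M = (Fintype.card n : ℂ)⁻¹ * (ψ M).trace := fun M => rfl
  have h := card_mul_eq_trace f (by rw [hf, map_one, Matrix.trace_one, inv_mul_cancel₀ hn])
    (fun M N => by rw [hf, hf, map_mul, map_mul, Matrix.trace_mul_comm]) (Matrix.single i i 1)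
  obtain ⟨r, hr⟩ := exists_trace_eq_natCast (M := ψ (Matrix.single i i 1))
    (by rw [IsIdempotentElem, ← map_mul, Matrix.single_mul_single_same, one_mul])
  rw [hf, hr, Matrix.trace_single_eq_same] at h
  refine ⟨r, ?_⟩
  have : (Fintype.card k : ℂ) * r = Fintype.card n := by
    field_simp at h
    exact h
  exact_mod_cast this.symm

end Matrix

/-! ### Growth of the sizes, and the unique tracial state. -/

section Filtration

open scoped Matrix Matrix.Norms.L2Operator

variable {A : Type*} [CStarAlgebra A] {S : ℕ → StarSubalgebra ℂ A} {m : ℕ → ℕ}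

namespace IsUHFFiltration

/-- The `n`-th algebra as the image of a faithful representation of a matrix algebra. -/
def hom (hS : IsUHFFiltration S m) (n : ℕ) : Matrix (Fin (m n)) (Fin (m n)) ℂ →⋆ₐ[ℂ] A :=
  (S n).subtype.comp ((hS.matrix n).some.symm : Matrix (Fin (m n)) (Fin (m n)) ℂ →⋆ₐ[ℂ] S n)

theorem hom_injective (hS : IsUHFFiltration S m) (n : ℕ) : Function.Injective (hS.hom n) :=
  Subtype.val_injective.comp (hS.matrix n).some.symm.injective

theorem mem_iff (hS : IsUHFFiltration S m) {n : ℕ} {a : A} : a ∈ S n ↔ ∃ M, hS.hom n M = a := by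
  constructor
  · intro h
    exact ⟨(hS.matrix n).some ⟨a, h⟩, congrArg Subtype.val ((hS.matrix n).some.symm_apply_apply _)⟩
  · rintro ⟨M, rfl⟩
    exact ((hS.matrix n).some.symm M).2

theorem norm_hom (hS : IsUHFFiltration S m) (n : ℕ) (M : Matrix (Fin (m n)) (Fin (m n)) ℂ) :
    ‖hS.hom n M‖ = ‖M‖ :=
  NonUnitalStarAlgHom.norm_map (hS.hom n) (hS.hom_injective n) M

theorem nontrivial (hS : IsUHFFiltration S m) : Nontrivial A := by
  by_contra h
  rw [not_nontrivial_iff_subsingleton] at h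
  have h0 : ∀ n, m n = 0 := fun n => by
    by_contra hn
    have : Nonempty (Fin (m n)) := ⟨⟨0, Nat.pos_of_ne_zero hn⟩⟩
    exact one_ne_zero (hS.hom_injective n (Subsingleton.elim (hS.hom n 1) (hS.hom n 0)))
  have := hS.strictMono zero_lt_one
  simp [h0] at this

theorem pos (hS : IsUHFFiltration S m) (n : ℕ) : 0 < m n := by
  have := hS.nontrivial
  by_contra h
  have : IsEmpty (Fin (m n)) := by
    rw [Nat.eq_zero_of_not_pos h]
    infer_instance
  have h1 : hS.hom n 1 = hS.hom n 0 := congrArg _ (Subsingleton.elim _ _)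
  rw [map_one, map_zero] at h1
  exact one_ne_zero h1

theorem two_mul_le_succ (hS : IsUHFFiltration S m) (n : ℕ) : 2 * m n ≤ m (n + 1) := by
  have h₁ : Nonempty (Fin (m n)) := ⟨⟨0, hS.pos n⟩⟩
  have h₂ : Nonempty (Fin (m (n + 1))) := ⟨⟨0, hS.pos (n + 1)⟩⟩
  have := card_dvd_card_of_algHom
    ((((hS.matrix (n + 1)).some : S (n + 1) →⋆ₐ[ℂ] Matrix (Fin (m (n + 1))) (Fin (m (n + 1))) ℂ).comp
    ((StarSubalgebra.inclusion (hS.mono n.le_succ)).comp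
      ((hS.matrix n).some.symm : Matrix (Fin (m n)) (Fin (m n)) ℂ →⋆ₐ[ℂ] S n))).toAlgHom)
  rw [Fintype.card_fin, Fintype.card_fin] at this
  obtain ⟨r, hr⟩ := this
  have hlt : m n < m (n + 1) := hS.strictMono n.lt_succ_self
  have : 2 ≤ r := by
    by_contra h
    have : r = 0 ∨ r = 1 := by omega
    rcases this with rfl | rfl <;> simp at hr <;> omega
  rw [hr, mul_comm]
  exact Nat.mul_le_mul_left _ this

theorem two_pow_le (hS : IsUHFFiltration S m) (n : ℕ) : 2 ^ n ≤ m n := by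
  induction n with
  | zero => exact hS.pos 0
  | succ n ih => rw [pow_succ']; exact (Nat.mul_le_mul_left 2 ih).trans (hS.two_mul_le_succ n)

/-- A normalized functional which is tracial on `S n` is the normalized trace there. -/
theorem apply_hom (hS : IsUHFFiltration S m) {n : ℕ} (f : A →ₗ[ℂ] ℂ) (h1 : f 1 = 1)
    (hf : ∀ a ∈ S n, ∀ b ∈ S n, f (a * b) = f (b * a)) (M : Matrix (Fin (m n)) (Fin (m n)) ℂ) :
    f (hS.hom n M) = (m n : ℂ)⁻¹ * M.trace := by
  have h := card_mul_eq_trace (f ∘ₗ (hS.hom n).toAlgHom.toLinearMap) (by simpa using h1)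
    (fun M N => by simpa using hf _ (hS.mem_iff.2 ⟨M, rfl⟩) _ (hS.mem_iff.2 ⟨N, rfl⟩)) M
  have hn : (m n : ℂ) ≠ 0 := by exact_mod_cast (hS.pos n).ne'
  rw [← h, Fintype.card_fin, inv_mul_cancel_left₀ hn]
  rfl

/-- A Hahn–Banach extension of the normalised trace of S n. The bound 1 is uniform in n, as
compactness will require. -/
theorem exists_dual (hS : IsUHFFiltration S m) (n : ℕ) :
    ∃ g : StrongDual ℂ A, ‖g‖ ≤ 1 ∧ ∀ M, g (hS.hom n M) = (m n : ℂ)⁻¹ * M.trace := by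
  have hn : (0 : ℝ) < m n := by exact_mod_cast hS.pos n
  let p : Subspace ℂ A := (S n).toSubalgebra.toSubmodule
  let f : p →ₗ[ℂ] ℂ := (m n : ℂ)⁻¹ • (Matrix.traceLinearMap (Fin (m n)) ℂ ℂ ∘ₗ
    ((hS.matrix n).some : S n →⋆ₐ[ℂ] Matrix (Fin (m n)) (Fin (m n)) ℂ).toAlgHom.toLinearMap)
  have hf : ∀ M (h : hS.hom n M ∈ p), f ⟨hS.hom n M, h⟩ = (m n : ℂ)⁻¹ * M.trace := fun M h => by
    have : (hS.matrix n).some ⟨hS.hom n M, h⟩ = M := (hS.matrix n).some.apply_symm_apply M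
    change (m n : ℂ)⁻¹ * ((hS.matrix n).some ⟨hS.hom n M, h⟩).trace = _
    rw [this]
  have hb : ∀ x, ‖f x‖ ≤ 1 * ‖x‖ := by
    rintro ⟨x, hx⟩
    obtain ⟨M, rfl⟩ := hS.mem_iff.1 hx
    rw [hf, one_mul, Submodule.coe_norm, hS.norm_hom, norm_mul, norm_inv, Complex.norm_natCast,
      inv_mul_le_iff₀ hn]
    simpa using norm_trace_le M
  obtain ⟨g, hg, hgn⟩ := exists_extension_norm_eq p (f.mkContinuous 1 hb)
  refine ⟨g, hgn.trans_le (f.mkContinuous_norm_le zero_le_one hb), fun M => ?_⟩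
  have hM : hS.hom n M ∈ p := hS.mem_iff.2 ⟨M, rfl⟩
  exact (hg ⟨_, hM⟩).trans (hf M hM)

/-- The functionals in the dual unit ball that are normalised and tracial on S n form decreasing
nonempty weak-* compact sets; a common point exists by Banach–Alaoglu. -/
theorem exists_tracial_functional (hS : IsUHFFiltration S m) :
    ∃ φ : WeakDual ℂ A, φ 1 = 1 ∧ ∀ n, ∀ a ∈ S n, ∀ b ∈ S n, φ (a * b) = φ (b * a) := by
  let K : ℕ → Set (WeakDual ℂ A) := fun n =>
    (WeakDual.toStrongDual ⁻¹' Metric.closedBall (0 : StrongDual ℂ A) 1) ∩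
      ({φ | φ 1 = 1} ∩ ⋂ a ∈ S n, ⋂ b ∈ S n, {φ | φ (a * b) = φ (b * a)})
  have hcl : ∀ n, IsClosed ({φ : WeakDual ℂ A | φ 1 = 1} ∩
      ⋂ a ∈ S n, ⋂ b ∈ S n, {φ | φ (a * b) = φ (b * a)}) := fun n =>
    (isClosed_eq (WeakDual.eval_continuous _) continuous_const).inter <|
      isClosed_biInter fun a _ => isClosed_biInter fun b _ =>
        isClosed_eq (WeakDual.eval_continuous _) (WeakDual.eval_continuous _)
  have hball := WeakDual.isCompact_closedBall (0 : StrongDual ℂ A) 1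
  obtain ⟨φ, hφ⟩ := IsCompact.nonempty_iInter_of_sequence_nonempty_isCompact_isClosed K
    (fun n => Set.inter_subset_inter_right _ (Set.inter_subset_inter_right _ fun φ hφ => by
      simp only [Set.mem_iInter] at hφ ⊢
      exact fun a ha b hb => hφ a (hS.mono n.le_succ ha) b (hS.mono n.le_succ hb)))
    (fun n => by
      obtain ⟨g, hg, hgM⟩ := hS.exists_dual n
      refine ⟨StrongDual.toWeakDual g, by simpa using hg, ?_, ?_⟩
      · have hn : (m n : ℂ) ≠ 0 := by exact_mod_cast (hS.pos n).ne'
        have := hgM 1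
        rw [map_one, Matrix.trace_one, Fintype.card_fin, inv_mul_cancel₀ hn] at this
        exact this
      · simp only [Set.mem_iInter]
        intro a ha b hb
        obtain ⟨M, rfl⟩ := hS.mem_iff.1 ha
        obtain ⟨N, rfl⟩ := hS.mem_iff.1 hb
        change g _ = g _
        rw [← map_mul, ← map_mul, hgM, hgM, Matrix.trace_mul_comm])
    (hball.inter_right (hcl 0)) (fun n => (WeakDual.isClosed_closedBall _ _).inter (hcl n))
  simp only [K, Set.mem_iInter, Set.mem_inter_iff] at hφ
  exact ⟨φ, (hφ 0).2.1, fun n a ha b hb => (hφ n).2.2 a ha b hb⟩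

variable [PartialOrder A] [StarOrderedRing A]

theorem exists_isTracialState (hS : IsUHFFiltration S m) :
    ∃ τ : A →ₚ[ℂ] ℂ, IsTracialState τ := by
  obtain ⟨φ, h1, hφ⟩ := hS.exists_tracial_functional
  have hpos : ∀ b : A, 0 ≤ φ (star b * b) := fun b => by
    have hc : IsClosed {b : A | 0 ≤ φ (star b * b)} :=
      isClosed_le continuous_const ((map_continuous φ).comp (by fun_prop))
    refine hc.closure_subset_iff.2 ?_ (hS.dense b)
    refine Set.iUnion_subset fun n => ?_
    intro b hb
    obtain ⟨M, rfl⟩ := hS.mem_iff.1 hb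
    have := hS.apply_hom (φ : A →ₗ[ℂ] ℂ) h1 (hφ n) (star M * M)
    rw [map_mul, map_star] at this
    refine le_of_le_of_eq ?_ this.symm
    exact mul_nonneg (by positivity) (Matrix.posSemidef_conjTranspose_mul_self M).trace_nonneg
  refine ⟨PositiveLinearMap.mk₀ (φ : A →ₗ[ℂ] ℂ) fun x hx => ?_, h1, fun a b => ?_⟩
  · obtain ⟨b, rfl⟩ := CStarAlgebra.nonneg_iff_eq_star_mul_self.1 hx
    exact hpos b
  · have hc : IsClosed {p : A × A | φ (p.1 * p.2) = φ (p.2 * p.1)} :=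
      isClosed_eq ((map_continuous φ).comp (by fun_prop)) ((map_continuous φ).comp (by fun_prop))
    refine hc.closure_subset_iff.2 ?_ ((hS.dense.prod hS.dense) (a, b))
    rintro ⟨a, b⟩ ⟨ha, hb⟩
    obtain ⟨i, hi⟩ := Set.mem_iUnion.1 ha
    obtain ⟨j, hj⟩ := Set.mem_iUnion.1 hb
    exact hφ (max i j) a (hS.mono (le_max_left _ _) hi) b (hS.mono (le_max_right _ _) hj)

omit [StarOrderedRing A] in
theorem tracialState_apply_hom (hS : IsUHFFiltration S m) {τ : A →ₚ[ℂ] ℂ} (hτ : IsTracialState τ)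
    {n : ℕ} (M : Matrix (Fin (m n)) (Fin (m n)) ℂ) :
    τ (hS.hom n M) = (m n : ℂ)⁻¹ * M.trace :=
  hS.apply_hom τ.toLinearMap hτ.1 (fun a _ b _ => hτ.2 a b) M

theorem existsUnique_isTracialState (hS : IsUHFFiltration S m) :
    ∃! τ : A →ₚ[ℂ] ℂ, IsTracialState τ := by
  obtain ⟨τ, hτ⟩ := hS.exists_isTracialState
  refine ⟨τ, hτ, fun σ hσ => DFunLike.coe_injective ?_⟩
  refine Continuous.ext_on hS.dense (map_continuous σ) (map_continuous τ) fun a ha => ?_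
  obtain ⟨n, hn⟩ := Set.mem_iUnion.1 ha
  obtain ⟨M, rfl⟩ := hS.mem_iff.1 hn
  rw [hS.tracialState_apply_hom hσ, hS.tracialState_apply_hom hτ]

omit [StarOrderedRing A] in
theorem norm_sq_le_mul_tracialState (hS : IsUHFFiltration S m) {τ : A →ₚ[ℂ] ℂ}
    (hτ : IsTracialState τ) {n : ℕ} {c : A} (hc : c ∈ S n) :
    ‖c‖ ^ 2 ≤ m n * (τ (star c * c)).re := by
  obtain ⟨M, rfl⟩ := hS.mem_iff.1 hc
  have hn : (m n : ℝ) ≠ 0 := by exact_mod_cast (hS.pos n).ne'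
  rw [hS.norm_hom, ← map_star, ← map_mul, hS.tracialState_apply_hom hτ, ← Complex.ofReal_natCast,
    ← Complex.ofReal_inv, Complex.re_ofReal_mul, mul_inv_cancel_left₀ hn]
  exact norm_sq_le_trace M

end IsUHFFiltration

end Filtration

/-! ### Bounded commutators with a diagonal operator. -/

section Commutator

variable {H : Type*} [NormedAddCommGroup H] [InnerProductSpace ℂ H] [CompleteSpace H]
  {Q : ℕ → H →L[ℂ] H}

/-- A bounded operator commuting with all but finitely many of the projections has a bounded
commutator with the series operator. -/
theorem IsResolution.exists_isCommutator (hQ : IsResolution Q) (α : ℕ → ℝ) {b : H →L[ℂ] H} {k : ℕ}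
    (hb : ∀ n, k < n → ∀ x, Q n (b x) = b (Q n x)) :
    ∃ T, IsCommutator (seriesOp Q α) b T := by
  set D := seriesOp Q α
  -- The formal commutator of the series with b; the terms with j > k vanish.
  let T : H →L[ℂ] H := ∑ j ∈ Finset.range (k + 1), (dropZero α j : ℂ) • (Q j * b - b * Q j)
  have hT : ∀ x, T x =
      ∑ j ∈ Finset.range (k + 1), (dropZero α j : ℂ) • (Q j (b x) - b (Q j x)) := fun x => by
    simp [T]
  have key : ∀ x : D.domain, ∃ h : b x ∈ D.domain, D ⟨b x, h⟩ = b (D x) + T x := by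
    refine fun x => hQ.mem_graph_iff.2 fun n => ?_
    have hQT : Q n (T x) = ∑ j ∈ Finset.range (k + 1),
        ((if n = j then (dropZero α n : ℂ) • Q n (b x) else 0) -
          (dropZero α j : ℂ) • Q n (b (Q j x))) := by
      rw [hT, map_sum]
      refine Finset.sum_congr rfl fun j _ => ?_
      rw [map_smul, map_sub, hQ.apply_apply, smul_sub]
      split_ifs with h <;> simp [h]
    rw [map_add, hQT, Finset.sum_sub_distrib, Finset.sum_ite_eq]
    by_cases hn : k < n
    · rw [if_neg (by simp; omega), hb n hn, hQ.apply_seriesOp, map_smul, hb n hn,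
        Finset.sum_eq_zero, sub_zero, add_zero]
      intro j hj
      rw [hb n hn, hQ.apply_apply, if_neg (by simp at hj; omega), map_zero, smul_zero]
    -- For n ≤ k the expansion of Q n (b (D x)) stops at j = k, since Q n b Q j = Q n Q j b = 0 for
    -- j > k.
    · have h₁ : HasSum (fun j => (dropZero α j : ℂ) • Q n (b (Q j x))) (Q n (b (D x))) := by
        refine (((hQ.hasSum (D x)).mapL b).mapL (Q n)).congr_fun fun j => ?_
        rw [hQ.apply_seriesOp, map_smul, map_smul]
      have h₂ : HasSum (fun j => (dropZero α j : ℂ) • Q n (b (Q j x)))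
          (∑ j ∈ Finset.range (k + 1), (dropZero α j : ℂ) • Q n (b (Q j x))) := by
        refine hasSum_sum_of_ne_finset_zero fun j hj => ?_
        have hj : k < j := by simpa [Nat.lt_succ_iff] using hj
        rw [← hb j hj, hQ.apply_apply, if_neg (by omega), smul_zero]
      rw [if_pos (by simp; omega), h₁.unique h₂]
      abel
  exact ⟨T, fun x => (key x).1, fun x => by rw [(key x).2, add_sub_cancel_left]⟩

end Commutator

/-! ### The GNS space of the trace and the Dirac operator on it. -/

section GNS

variable {A : Type*} [CStarAlgebra A] [PartialOrder A] [StarOrderedRing A] {τ : A →ₚ[ℂ] ℂ}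
  {S : ℕ → StarSubalgebra ℂ A} {m : ℕ → ℕ}

theorem inner_gnsVec (a b : A) : ⟪gnsVec τ a, gnsVec τ b⟫_ℂ = τ (star a * b) := by
  change ⟪((τ.toPreGNS a : τ.PreGNS) : τ.GNS), ((τ.toPreGNS b : τ.PreGNS) : τ.GNS)⟫_ℂ = _
  rw [UniformSpace.Completion.inner_coe]
  rfl

theorem norm_sq_gnsVec (a : A) : ‖gnsVec τ a‖ ^ 2 = (τ (star a * a)).re := by
  rw [← inner_gnsVec, inner_self_eq_norm_sq_to_K]
  norm_cast

theorem gnsStarAlgHom_gnsVec (a b : A) : τ.gnsStarAlgHom a (gnsVec τ b) = gnsVec τ (a * b) := by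
  rw [gnsVec_eq τ b, gnsVec_eq τ (a * b), map_mul, mul_apply_eq_comp]

theorem denseRange_gnsVec : DenseRange (gnsVec τ) :=
  UniformSpace.Completion.denseRange_coe.comp τ.toPreGNS.surjective.denseRange
    (UniformSpace.Completion.continuous_coe _)

theorem norm_gnsStarAlgHom_le (a : A) : ‖τ.gnsStarAlgHom a‖ ≤ ‖a‖ :=
  NonUnitalStarAlgHom.norm_apply_le τ.gnsStarAlgHom a

theorem continuous_gnsVec : Continuous (gnsVec τ) := by
  have h : Continuous fun a => τ.gnsStarAlgHom a (gnsVec τ 1) :=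
    (ContinuousLinearMap.apply ℂ τ.GNS (gnsVec τ 1)).continuous.comp
      (AddMonoidHomClass.continuous_of_bound τ.gnsStarAlgHom 1 fun a => by
        simpa using norm_gnsStarAlgHom_le a)
  simpa only [← gnsVec_eq] using h

theorem norm_gnsVec_one (hτ : τ 1 = 1) : ‖gnsVec τ 1‖ = 1 := by
  have := norm_sq_gnsVec (τ := τ) 1
  rw [star_one, one_mul, hτ, Complex.one_re] at this
  exact (pow_eq_one_iff_of_nonneg (norm_nonneg _) two_ne_zero).1 this

/-- The subspace `η (S n)`. -/
def level (τ : A →ₚ[ℂ] ℂ) (S : ℕ → StarSubalgebra ℂ A) (n : ℕ) : Submodule ℂ τ.GNS :=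
  (S n).toSubalgebra.toSubmodule.map (gnsVec τ)

theorem mem_level {n : ℕ} {x : τ.GNS} : x ∈ level τ S n ↔ ∃ c ∈ S n, gnsVec τ c = x := Iff.rfl

theorem isSelfAdjoint_levelProj (n : ℕ) : IsSelfAdjoint (levelProj τ S n) :=
  isSelfAdjoint_starProjection _

theorem levelProj_of_mem {n : ℕ} {x : τ.GNS} (hx : x ∈ level τ S n) : levelProj τ S n x = x :=
  Submodule.starProjection_eq_self_iff.2 (Submodule.le_topologicalClosure _ hx)

theorem isSelfAdjoint_diffProj (n : ℕ) : IsSelfAdjoint (diffProj τ S n) := by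
  cases n with
  | zero => exact isSelfAdjoint_levelProj 0
  | succ n => exact (isSelfAdjoint_levelProj (n + 1)).sub (isSelfAdjoint_levelProj n)

theorem sum_diffProj (N : ℕ) :
    ∑ i ∈ Finset.range (N + 1), diffProj τ S i = levelProj τ S N := by
  induction N with
  | zero => simp [diffProj]
  | succ N ih => rw [Finset.sum_range_succ, ih, diffProj]; abel

namespace IsUHFFiltration

omit [PartialOrder A] [StarOrderedRing A] in
theorem range_hom (hS : IsUHFFiltration S m) (n : ℕ) :
    (hS.hom n).toAlgHom.toLinearMap.range = (S n).toSubalgebra.toSubmodule := by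
  ext a
  exact hS.mem_iff.symm

omit [PartialOrder A] [StarOrderedRing A] in
theorem finiteDimensional (hS : IsUHFFiltration S m) (n : ℕ) :
    FiniteDimensional ℂ (S n).toSubalgebra.toSubmodule := by
  rw [← hS.range_hom]
  infer_instance

theorem finiteDimensional_level (hS : IsUHFFiltration S m) (n : ℕ) :
    FiniteDimensional ℂ (level τ S n) := by
  have := hS.finiteDimensional n
  unfold level
  infer_instance

theorem finrank_level_le (hS : IsUHFFiltration S m) (n : ℕ) :
    Module.finrank ℂ (level τ S n) ≤ m n ^ 2 := by
  have := hS.finiteDimensional n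
  refine (Submodule.finrank_map_le _ _).trans ?_
  rw [← hS.range_hom]
  refine (LinearMap.finrank_range_le _).trans ?_
  simp [Module.finrank_matrix, sq]

theorem levelProj_mem (hS : IsUHFFiltration S m) (n : ℕ) (x : τ.GNS) :
    levelProj τ S n x ∈ level τ S n := by
  have := hS.finiteDimensional_level (τ := τ) n
  have h : levelProj τ S n x ∈ (level τ S n).topologicalClosure :=
    Submodule.starProjection_apply_mem _ _
  rwa [(level τ S n).closed_of_finiteDimensional.submodule_topologicalClosure_eq] at h

theorem level_mono (hS : IsUHFFiltration S m) : Monotone (level τ S) := fun _ _ h =>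
  Submodule.map_mono (hS.mono h)

theorem levelProj_mul_levelProj (hS : IsUHFFiltration S m) (i j : ℕ) :
    levelProj τ S i * levelProj τ S j = levelProj τ S (min i j) := by
  have h : ∀ i j, i ≤ j → levelProj τ S j * levelProj τ S i = levelProj τ S i := fun i j hij =>
    ContinuousLinearMap.ext fun x => levelProj_of_mem (hS.level_mono hij (hS.levelProj_mem i x))
  rcases le_total i j with hij | hij
  · rw [min_eq_left hij]
    have := congrArg star (h i j hij)
    rwa [star_mul, (isSelfAdjoint_levelProj i).star_eq, (isSelfAdjoint_levelProj j).star_eq] at this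
  · rw [min_eq_right hij, h j i hij]

theorem diffProj_mul_diffProj (hS : IsUHFFiltration S m) (i j : ℕ) :
    diffProj τ S i * diffProj τ S j = if i = j then diffProj τ S i else 0 := by
  have hP : ∀ i k, i ≤ k → diffProj τ S i * levelProj τ S k = diffProj τ S i := fun i k h => by
    cases i with
    | zero => rw [diffProj, hS.levelProj_mul_levelProj, min_eq_left h]
    | succ i =>
      rw [diffProj, sub_mul, hS.levelProj_mul_levelProj, hS.levelProj_mul_levelProj, min_eq_left h,
        min_eq_left (by omega)]
  have hlt : ∀ i j, i < j → diffProj τ S i * diffProj τ S j = 0 := fun i j h => by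
    obtain ⟨j, rfl⟩ := Nat.exists_eq_add_one_of_ne_zero (by omega : j ≠ 0)
    rw [show diffProj τ S (j + 1) = levelProj τ S (j + 1) - levelProj τ S j from rfl, mul_sub,
      hP i _ h.le, hP i _ (by omega), sub_self]
  rcases lt_trichotomy i j with h | rfl | h
  · rw [if_neg h.ne, hlt i j h]
  · rw [if_pos rfl]
    cases i <;> simp [diffProj, mul_sub, sub_mul, hS.levelProj_mul_levelProj]
  · rw [if_neg h.ne']
    have := congrArg star (hlt j i h)
    rwa [star_mul, (isSelfAdjoint_diffProj i).star_eq, (isSelfAdjoint_diffProj j).star_eq,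
      star_zero] at this

theorem isResolution (hS : IsUHFFiltration S m) : IsResolution (diffProj τ S) where
  isSelfAdjoint := isSelfAdjoint_diffProj
  mul_eq := hS.diffProj_mul_diffProj
  tendsto x := by
    rw [← tendsto_add_atTop_iff_nat 1]
    have : Tendsto (fun N => levelProj τ S N x) atTop (𝓝 x) := by
      refine Submodule.starProjection_tendsto_self
        (fun n => (level τ S n).topologicalClosure)
        (fun i j h => Submodule.topologicalClosure_mono (hS.level_mono h)) x ?_
      intro y _
      have hd := denseRange_gnsVec (τ := τ) |>.dense_image continuous_gnsVec hS.dense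
      refine closure_mono ?_ (hd y)
      rintro _ ⟨a, ha, rfl⟩
      obtain ⟨n, hn⟩ := Set.mem_iUnion.1 ha
      exact Submodule.mem_iSup_of_mem n (Submodule.le_topologicalClosure _ ⟨a, hn, rfl⟩)
    refine this.congr fun N => ?_
    rw [← sum_diffProj, sum_apply]

theorem range_diffProj_le (hS : IsUHFFiltration S m) (n : ℕ) :
    (diffProj τ S n).range ≤ level τ S n := by
  rintro _ ⟨x, rfl⟩
  cases n with
  | zero => exact hS.levelProj_mem 0 x
  | succ n =>
    exact Submodule.sub_mem _ (hS.levelProj_mem _ x)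
      (hS.level_mono n.le_succ (hS.levelProj_mem n x))

theorem finiteDimensional_range_diffProj (hS : IsUHFFiltration S m) (n : ℕ) :
    FiniteDimensional ℂ (diffProj τ S n).range := by
  have := hS.finiteDimensional_level (τ := τ) n
  exact Submodule.finiteDimensional_of_le (hS.range_diffProj_le n)

theorem finrank_range_diffProj_le (hS : IsUHFFiltration S m) (n : ℕ) :
    Module.finrank ℂ (diffProj τ S n).range ≤ m n ^ 2 := by
  have := hS.finiteDimensional_level (τ := τ) n
  exact (Submodule.finrank_mono (hS.range_diffProj_le n)).trans (hS.finrank_level_le n)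

/-- The subspace η(S k) is invariant under both a and its adjoint, hence reducing. -/
theorem levelProj_commute (hS : IsUHFFiltration S m) {k : ℕ} {a : A} (ha : a ∈ S k) :
    levelProj τ S k * τ.gnsStarAlgHom a = τ.gnsStarAlgHom a * levelProj τ S k := by
  have h : ∀ a ∈ S k, levelProj τ S k * (τ.gnsStarAlgHom a * levelProj τ S k) =
      τ.gnsStarAlgHom a * levelProj τ S k := fun a ha => ContinuousLinearMap.ext fun x => by
    refine levelProj_of_mem ?_
    obtain ⟨c, hc, hx⟩ := mem_level.1 (hS.levelProj_mem k x)
    change τ.gnsStarAlgHom a (levelProj τ S k x) ∈ level τ S k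
    rw [← hx, gnsStarAlgHom_gnsVec]
    exact ⟨a * c, (S k).mul_mem ha hc, rfl⟩
  have h' := congrArg star (h (star a) (star_mem ha))
  simp only [star_mul, (isSelfAdjoint_levelProj k).star_eq, map_star, star_star] at h'
  rw [← h', mul_assoc, h a ha]

theorem diffProj_apply_gnsStarAlgHom (hS : IsUHFFiltration S m) {k n : ℕ} (hn : k < n) {a : A}
    (ha : a ∈ S k) (x : τ.GNS) :
    diffProj τ S n (τ.gnsStarAlgHom a x) = τ.gnsStarAlgHom a (diffProj τ S n x) := by
  obtain ⟨n, rfl⟩ := Nat.exists_eq_add_one_of_ne_zero (by omega : n ≠ 0)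
  have h : ∀ i, k ≤ i → levelProj τ S i (τ.gnsStarAlgHom a x) =
      τ.gnsStarAlgHom a (levelProj τ S i x) := fun i hi =>
    congrArg (fun T : τ.GNS →L[ℂ] τ.GNS => T x) (hS.levelProj_commute (hS.mono hi ha))
  rw [diffProj, sub_apply, sub_apply, h _ (by omega), h _ (by omega), map_sub]

theorem dense_isCommutator (hS : IsUHFFiltration S m) (α : ℕ → ℝ) :
    Dense {a : A | ∃ T, IsCommutator (dirac τ S α) (τ.gnsStarAlgHom a) T} := by
  refine hS.dense.mono (Set.iUnion_subset fun k a ha => ?_)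
  exact hS.isResolution.exists_isCommutator α fun n hn x =>
    hS.diffProj_apply_gnsStarAlgHom hn ha x

theorem norm_le_sqrt_mul_norm_gnsVec (hS : IsUHFFiltration S m) (hτ : IsTracialState τ) {n : ℕ}
    {c : A} (hc : c ∈ S n) : ‖c‖ ≤ √(m n) * ‖gnsVec τ c‖ := by
  rw [← sq_le_sq₀ (norm_nonneg _) (by positivity), mul_pow, Real.sq_sqrt (by positivity),
    norm_sq_gnsVec]
  exact hS.norm_sq_le_mul_tracialState hτ hc

open scoped Matrix.Norms.L2Operator in
/-- The GNS representation of the tracial state is isometric. -/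
theorem norm_gnsStarAlgHom (hS : IsUHFFiltration S m) (hτ : IsTracialState τ) (a : A) :
    ‖τ.gnsStarAlgHom a‖ = ‖a‖ := by
  have hcl : IsClosed {a : A | ‖τ.gnsStarAlgHom a‖ = ‖a‖} :=
    isClosed_eq (AddMonoidHomClass.continuous_of_bound τ.gnsStarAlgHom 1 fun a => by
        simpa using norm_gnsStarAlgHom_le a).norm continuous_norm
  refine hcl.closure_subset_iff.2 (Set.iUnion_subset fun n a ha => ?_) (hS.dense a)
  obtain ⟨M, rfl⟩ := hS.mem_iff.1 ha
  -- If c in S n acts as zero, then η(c) = 0 and the √m_n estimate gives c = 0; injective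
  -- *-homomorphisms are isometric.
  have hinj : Function.Injective (τ.gnsStarAlgHom.comp (hS.hom n)) := by
    rw [injective_iff_map_eq_zero]
    intro M hM
    refine hS.hom_injective n ?_
    rw [map_zero, ← norm_le_zero_iff]
    refine (hS.norm_le_sqrt_mul_norm_gnsVec hτ (hS.mem_iff.2 ⟨M, rfl⟩)).trans (le_of_eq ?_)
    have : τ.gnsStarAlgHom (hS.hom n M) = 0 := hM
    rw [gnsVec_eq, this]
    simp
  have := NonUnitalStarAlgHom.norm_map (τ.gnsStarAlgHom.comp (hS.hom n)) hinj M
  exact this.trans (hS.norm_hom n M).symm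

/-- The tracial state is faithful. -/
theorem eq_zero_of_gnsVec_eq_zero (hS : IsUHFFiltration S m) (hτ : IsTracialState τ) {a : A}
    (ha : gnsVec τ a = 0) : a = 0 := by
  -- Traciality gives ‖η(x*)‖ = ‖η(x)‖, so the null space of η, a left ideal, is also a right ideal.
  have h : ∀ b, gnsVec τ (a * b) = 0 := fun b => by
    have h₁ : ‖gnsVec τ (star a)‖ ^ 2 = 0 := by
      rw [norm_sq_gnsVec, star_star, hτ.2, ← norm_sq_gnsVec, ha, norm_zero, zero_pow two_ne_zero]
    have h₂ : gnsVec τ (star b * star a) = 0 := by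
      rw [← gnsStarAlgHom_gnsVec, norm_eq_zero.1 (pow_eq_zero_iff two_ne_zero |>.1 h₁), map_zero]
    have h₃ : ‖gnsVec τ (a * b)‖ ^ 2 = 0 := by
      rw [norm_sq_gnsVec, hτ.2, ← star_star (a * b), star_star (star _), ← norm_sq_gnsVec, star_mul,
        h₂, norm_zero, zero_pow two_ne_zero]
    exact norm_eq_zero.1 (pow_eq_zero_iff two_ne_zero |>.1 h₃)
  have hπ : τ.gnsStarAlgHom a = 0 := by
    refine ContinuousLinearMap.ext fun x => ?_
    refine congrFun (denseRange_gnsVec.equalizer (map_continuous (τ.gnsStarAlgHom a))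
      continuous_zero (funext fun b => ?_)) x
    exact (gnsStarAlgHom_gnsVec a b).trans (h b)
  rw [← norm_eq_zero, ← hS.norm_gnsStarAlgHom hτ, hπ, norm_zero]

/-- Since D kills ξ = η(1), the commutator sends ξ to D η(a), whose component in the range of Q
(n+1) carries the factor α (n+1). -/
theorem norm_diffProj_gnsVec_le (hS : IsUHFFiltration S m) (hτ : IsTracialState τ) {α : ℕ → ℝ}
    {n : ℕ} (hα : α (n + 1) ≠ 0) {a : A} {T : τ.GNS →L[ℂ] τ.GNS}
    (hT : IsCommutator (dirac τ S α) (τ.gnsStarAlgHom a) T) :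
    ‖diffProj τ S (n + 1) (gnsVec τ a)‖ ≤ |α (n + 1)|⁻¹ * ‖T‖ := by
  have hQ := hS.isResolution (τ := τ)
  obtain ⟨h₁, h₂⟩ := hT
  have hξ : ∀ n, levelProj τ S n (gnsVec τ 1) = gnsVec τ 1 := fun n =>
    levelProj_of_mem ⟨1, one_mem (S n), rfl⟩
  obtain ⟨hd, hD⟩ : ∃ h, dirac τ S α ⟨gnsVec τ 1, h⟩ = 0 := hQ.mem_graph_iff.2 fun n => by
    cases n with
    | zero => simp [dropZero]
    | succ n => simp [diffProj, hξ]
  have h₃ := h₂ ⟨_, hd⟩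
  rw [hD, map_zero, sub_zero] at h₃
  have h₄ : diffProj τ S (n + 1) (T (gnsVec τ 1)) =
      (α (n + 1) : ℂ) • diffProj τ S (n + 1) (τ.gnsStarAlgHom a (gnsVec τ 1)) :=
    hQ.mem_graph_iff.1 ⟨h₁ ⟨_, hd⟩, h₃⟩ (n + 1)
  have h₅ : |α (n + 1)| * ‖diffProj τ S (n + 1) (gnsVec τ a)‖ ≤ ‖T‖ := by
    have := hQ.norm_apply_le (n + 1) (T (gnsVec τ 1))
    rw [h₄, norm_smul, Complex.norm_real, Real.norm_eq_abs, ← gnsVec_eq] at this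
    refine this.trans ((T.le_opNorm _).trans ?_)
    rw [norm_gnsVec_one hτ.1, mul_one]
  rwa [← div_eq_inv_mul, le_div_iff₀' (abs_pos.2 hα)]

/-- Take c n in S n with η(c n) = P n η(a). The increments are summable in norm, and faithfulness of
τ identifies the limit with a. The rate does not depend on a. -/
theorem exists_approx (hS : IsUHFFiltration S m) (hτ : IsTracialState τ) {α : ℕ → ℝ}
    (hα : ∀ n, α (n + 1) ≠ 0) (hsum : Summable fun n => |α (n + 1)|⁻¹ * √(m (n + 1))) {a : A}
    {T : τ.GNS →L[ℂ] τ.GNS} (hT : IsCommutator (dirac τ S α) (τ.gnsStarAlgHom a) T)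
    (h1 : ‖T‖ ≤ 1) :
    ∃ c : ℕ → A, (∀ n, c n ∈ S n) ∧
      (∀ n, dist (c n) (c (n + 1)) ≤ |α (n + 1)|⁻¹ * √(m (n + 1))) ∧
      Tendsto c atTop (𝓝 a) := by
  choose c hc hη using fun n => mem_level.1 (hS.levelProj_mem n (gnsVec τ a))
  have hdist : ∀ n, dist (c n) (c (n + 1)) ≤ |α (n + 1)|⁻¹ * √(m (n + 1)) := fun n => by
    rw [dist_comm, dist_eq_norm, mul_comm]
    refine (hS.norm_le_sqrt_mul_norm_gnsVec hτ
      (sub_mem (hc (n + 1)) (hS.mono n.le_succ (hc n)))).trans ?_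
    gcongr
    rw [map_sub, hη, hη]
    refine (hS.norm_diffProj_gnsVec_le hτ (hα n) hT).trans ?_
    exact mul_le_of_le_one_right (by positivity) h1
  refine ⟨c, hc, hdist, ?_⟩
  obtain ⟨b, hb⟩ := cauchySeq_tendsto_of_complete (cauchySeq_of_dist_le_of_summable _ hdist hsum)
  have h₁ : Tendsto (fun n => gnsVec τ (c n)) atTop (𝓝 (gnsVec τ b)) :=
    (continuous_gnsVec.tendsto b).comp hb
  have h₂ : Tendsto (fun n => gnsVec τ (c n)) atTop (𝓝 (gnsVec τ a)) := by
    refine ((tendsto_add_atTop_iff_nat 1).2 (hS.isResolution.tendsto (gnsVec τ a))).congr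
      fun n => ?_
    rw [← sum_apply, sum_diffProj, hη]
  have h₃ : gnsVec τ (a - b) = 0 := by rw [map_sub, tendsto_nhds_unique h₁ h₂, sub_self]
  rwa [sub_eq_zero.1 (hS.eq_zero_of_gnsVec_eq_zero hτ h₃)]

theorem inducesWeakStarMetric (hS : IsUHFFiltration S m) (hτ : IsTracialState τ) {α : ℕ → ℝ}
    (hα : ∀ n, α (n + 1) ≠ 0) (hsum : Summable fun n => |α (n + 1)|⁻¹ * √(m (n + 1))) :
    InducesWeakStarMetric τ.gnsStarAlgHom (dirac τ S α) := by
  refine inducesWeakStarMetric_of_totallyBounded (hS.dense_isCommutator α) fun ε hε => ?_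
  set γ : ℕ → ℝ := fun n => |α (n + 1)|⁻¹ * √(m (n + 1))
  obtain ⟨N, hN⟩ := ((tendsto_sum_nat_add γ).eventually_lt_const (half_pos hε)).exists
  have := hS.finiteDimensional N
  have := FiniteDimensional.proper ℂ (S N).toSubalgebra.toSubmodule
  -- The radius bounds ‖c N - c 0‖ through a: at most ε/2 from c N to a and the full sum of γ from c
  -- 0 to a.
  obtain ⟨t, ht, hcov⟩ := Metric.totallyBounded_iff.1
    (isCompact_closedBall (0 : (S N).toSubalgebra.toSubmodule) (∑' n, γ n + ε / 2)).totallyBounded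
    (ε / 2) (half_pos hε)
  refine ⟨Subtype.val '' t, ht.image _, fun a T hT h1 => ?_⟩
  obtain ⟨c, hc, hdist, hlim⟩ := hS.exists_approx hτ hα hsum hT h1
  have hc0 := hc 0
  rw [hS.bot] at hc0
  obtain ⟨z, hz⟩ := StarSubalgebra.mem_bot.1 hc0
  have h₁ : dist (c N) a ≤ ε / 2 := by
    refine (dist_le_tsum_of_dist_le_of_tendsto γ hdist hsum hlim N).trans ?_
    simpa only [add_comm N] using hN.le
  have h₂ : dist (c 0) a ≤ ∑' n, γ n := by
    simpa using dist_le_tsum_of_dist_le_of_tendsto γ hdist hsum hlim 0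
  let y : (S N).toSubalgebra.toSubmodule :=
    ⟨c N - c 0, sub_mem (hc N) (hS.mono (Nat.zero_le N) (hc 0))⟩
  have hy : y ∈ Metric.closedBall (0 : (S N).toSubalgebra.toSubmodule) (∑' n, γ n + ε / 2) := by
    rw [mem_closedBall_zero_iff]
    change ‖c N - c 0‖ ≤ _
    rw [← dist_eq_norm]
    have := dist_triangle_right (c N) (c 0) a
    linarith
  obtain ⟨b, hb, hyb⟩ := Set.mem_iUnion₂.1 (hcov hy)
  refine ⟨b, ⟨b, hb, rfl⟩, z, ?_⟩
  have h₃ : ‖c N - c 0 - b‖ < ε / 2 := by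
    rw [Metric.mem_ball, dist_eq_norm] at hyb
    exact hyb
  rw [dist_comm, dist_eq_norm] at h₁
  rw [hz, show a - c 0 - (b : A) = (a - c N) + (c N - c 0 - b) by abel]
  refine (norm_add_le _ _).trans ?_
  linarith

theorem isFredholmModule (hS : IsUHFFiltration S m) {α : ℕ → ℝ}
    (hα : ∀ n, α (n + 1) ≠ 0) (hsum : Summable fun n => |α (n + 1)|⁻¹ * √(m (n + 1))) :
    IsFredholmModule τ.gnsStarAlgHom (dirac τ S α) where
  selfAdjoint := hS.isResolution.isSelfAdjoint_seriesOp α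
  dense_bounded_commutator := hS.dense_isCommutator α
  compact_resolvent := by
    obtain ⟨R, hR, hdiag⟩ := hS.isResolution (τ := τ) |>.exists_inverse α
    refine ⟨R, hR, hS.isResolution.isCompactOperator_of_diag
      hS.finiteDimensional_range_diffProj ?_ hdiag⟩
    -- As m ≥ 1, (1 + α²)⁻¹ ≤ α⁻² ≤ (|α|⁻¹√m)², which tends to 0 by summability.
    rw [← tendsto_add_atTop_iff_nat 1]
    refine squeeze_zero (fun n => by positivity) (fun n => ?_)
      (by simpa using hsum.tendsto_atTop_zero.pow 2)
    have h₁ : (1 : ℝ) ≤ m (n + 1) := by exact_mod_cast hS.pos (n + 1)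
    have h₂ := sq_pos_of_ne_zero (hα n)
    rw [dropZero, mul_pow, inv_pow, sq_abs, Real.sq_sqrt (by positivity)]
    refine le_trans ?_ (le_mul_of_one_le_right (by positivity) h₁)
    exact inv_anti₀ h₂ (by linarith)

theorem isSummable (hS : IsUHFFiltration S m) {α : ℕ → ℝ} (hα : ∀ n, α (n + 1) ≠ 0) {p : ℝ}
    (hp : 0 < p) (hsum : Summable fun n => |α (n + 1)| ^ (-p) * (m (n + 1) : ℝ) ^ 2) :
    IsSummable (dirac τ S α) p := by
  obtain ⟨R, hR, hdiag⟩ := hS.isResolution (τ := τ) |>.exists_inverse α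
  refine ⟨R, hR, hS.isResolution.hasFiniteTrace_rpow hS.finiteDimensional_range_diffProj
    (by positivity) (fun n => by positivity) hdiag ?_⟩
  -- The term at 0, where D vanishes, is a single finite number and may be dropped.
  rw [← summable_nat_add_iff 1]
  refine hsum.of_nonneg_of_le (fun n => by positivity) fun n => ?_
  have h₂ := sq_pos_of_ne_zero (hα n)
  refine mul_le_mul ?_ (by exact_mod_cast hS.finrank_range_diffProj_le (n + 1)) (by positivity)
    (by positivity)
  rw [dropZero, show |α (n + 1)| ^ (-p) = ((α (n + 1) ^ 2)⁻¹) ^ (p / 2) by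
    rw [← sq_abs, ← Real.rpow_natCast, ← Real.rpow_neg (abs_nonneg _),
      ← Real.rpow_mul (abs_nonneg _)]
    congr 1
    push_cast
    ring]
  exact Real.rpow_le_rpow (by positivity) (inv_anti₀ h₂ (by linarith)) (by positivity)

omit [PartialOrder A] [StarOrderedRing A] in
theorem summable_rpow_neg (hS : IsUHFFiltration S m) {δ : ℝ} (hδ : 0 < δ) :
    Summable fun n => (m (n + 1) : ℝ) ^ (-δ) := by
  have h : Summable fun n : ℕ => ((2 : ℝ) ^ (-δ)) ^ n :=
    summable_geometric_of_lt_one (by positivity)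
      (Real.rpow_lt_one_of_one_lt_of_neg one_lt_two (by linarith))
  refine ((summable_nat_add_iff 1).2 h).of_nonneg_of_le (fun n => by positivity) fun n => ?_
  rw [← Real.rpow_natCast, ← Real.rpow_mul two_pos.le, mul_comm, Real.rpow_mul two_pos.le,
    Real.rpow_natCast]
  exact Real.rpow_le_rpow_of_nonpos (by positivity) (by exact_mod_cast hS.two_pow_le (n + 1))
    (by linarith)

end IsUHFFiltration

end GNS

end UHFTriple

end

/-! ### The two families of eigenvalues. -/

theorem theorem3p1 {A : Type*} [CStarAlgebra A] [PartialOrder A] [StarOrderedRing A]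
    (S : ℕ → StarSubalgebra ℂ A) (m : ℕ → ℕ) (hS : UHFTriple.IsUHFFiltration S m) :
    (∃! τ : A →ₚ[ℂ] ℂ, UHFTriple.IsTracialState τ) ∧
    ∀ τ : A →ₚ[ℂ] ℂ, UHFTriple.IsTracialState τ →
      (∀ β : ℕ → ℝ, (∀ n, 1 ≤ n → β n ≠ 0) → (Summable fun n : ℕ => |β (n + 1)|) →
        UHFTriple.IsFredholmModule τ.gnsStarAlgHom
            (UHFTriple.dirac τ S fun n => (β n)⁻¹ * √(m n : ℝ)) ∧
          UHFTriple.InducesWeakStarMetric τ.gnsStarAlgHom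
            (UHFTriple.dirac τ S fun n => (β n)⁻¹ * √(m n : ℝ)) ∧
          UHFTriple.IsSummable (UHFTriple.dirac τ S fun n => (β n)⁻¹ * √(m n : ℝ)) 4) ∧
      (∀ p s : ℝ, 0 < p → p < 2 → 2 / p < s →
        UHFTriple.IsFredholmModule τ.gnsStarAlgHom
            (UHFTriple.dirac τ S fun n => (m n : ℝ) ^ s) ∧
          UHFTriple.InducesWeakStarMetric τ.gnsStarAlgHom
            (UHFTriple.dirac τ S fun n => (m n : ℝ) ^ s) ∧
          UHFTriple.IsSummable (UHFTriple.dirac τ S fun n => (m n : ℝ) ^ s) p) := by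
  have hm : ∀ n, (0 : ℝ) < m n := fun n => by exact_mod_cast hS.pos n
  refine ⟨hS.existsUnique_isTracialState, fun τ hτ => ⟨fun β hβ hsum => ?_,
    fun p s hp hp2 hs => ?_⟩⟩
  · have hβ' : ∀ n, β (n + 1) ≠ 0 := fun n => hβ (n + 1) (by omega)
    have hα : ∀ n, (β (n + 1))⁻¹ * √(m (n + 1) : ℝ) ≠ 0 := fun n =>
      mul_ne_zero (inv_ne_zero (hβ' n)) (Real.sqrt_pos.2 (hm _)).ne'
    have hγ : Summable fun n => |(β (n + 1))⁻¹ * √(m (n + 1) : ℝ)|⁻¹ * √(m (n + 1) : ℝ) := by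
      refine hsum.congr fun n => ?_
      rw [abs_mul, abs_inv, abs_of_pos (Real.sqrt_pos.2 (hm (n + 1))), mul_inv, inv_inv, mul_assoc,
        inv_mul_cancel₀ (Real.sqrt_pos.2 (hm (n + 1))).ne', mul_one]
    refine ⟨hS.isFredholmModule hα hγ, hS.inducesWeakStarMetric hτ hα hγ,
      hS.isSummable hα (by norm_num) ?_⟩
    -- For p = 4 the factor m² cancels and leaves |β|⁴, bounded by (∑|β|)³ |β|.
    refine (hsum.mul_left ((∑' n, |β (n + 1)|) ^ 3)).of_nonneg_of_le (fun n => by positivity)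
      fun n => ?_
    have hle := hsum.le_tsum n fun _ _ => abs_nonneg _
    calc |(β (n + 1))⁻¹ * √(m (n + 1) : ℝ)| ^ (-4 : ℝ) * (m (n + 1) : ℝ) ^ 2
        = |β (n + 1)| ^ 3 * |β (n + 1)| := by
          rw [Real.rpow_neg (abs_nonneg _), show (4 : ℝ) = ((4 : ℕ) : ℝ) by norm_num,
            Real.rpow_natCast, abs_mul, mul_pow, abs_of_pos (Real.sqrt_pos.2 (hm (n + 1))),
            show √(m (n + 1) : ℝ) ^ 4 = (√(m (n + 1) : ℝ) ^ 2) ^ 2 by ring,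
            Real.sq_sqrt (hm _).le, abs_inv, mul_inv, inv_pow, inv_inv, mul_assoc,
            inv_mul_cancel₀ (pow_ne_zero 2 (hm (n + 1)).ne')]
          ring
      _ ≤ _ := by gcongr
  · have h1 : 1 < 2 / p := (one_lt_div hp).2 hp2
    have hα : ∀ n, (m (n + 1) : ℝ) ^ s ≠ 0 := fun n => (Real.rpow_pos_of_pos (hm _) _).ne'
    have hγ : Summable fun n => |(m (n + 1) : ℝ) ^ s|⁻¹ * √(m (n + 1) : ℝ) := by
      -- Here s > 2/p > 1, which leaves room above the 1/2 needed for the metric; summability below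
      -- uses s p > 2 in full.
      refine (hS.summable_rpow_neg (δ := s - 1 / 2) (by linarith)).congr fun n => ?_
      rw [abs_of_pos (Real.rpow_pos_of_pos (hm _) _), ← Real.rpow_neg (hm _).le, Real.sqrt_eq_rpow,
        ← Real.rpow_add (hm _)]
      congr 1
      ring
    refine ⟨hS.isFredholmModule hα hγ, hS.inducesWeakStarMetric hτ hα hγ, hS.isSummable hα hp ?_⟩
    have h2 : 0 < s * p - 2 := by
      have := (div_lt_iff₀ hp).1 hs
      linarith
    refine (hS.summable_rpow_neg h2).congr fun n => ?_
    rw [abs_of_pos (Real.rpow_pos_of_pos (hm _) _), ← Real.rpow_mul (hm _).le,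
      ← Real.rpow_natCast, ← Real.rpow_add (hm _)]
    congr 1
    push_cast
    ring
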